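/- Let $n\ge 1$ be an integer. For real coefficients $a_0,\dots,a_n,b_1,\dots,b_n$ put $$f_n(t)=\frac{a_0}{2}+\sum_{k=1}^{n}(a_k\cos kt+b_k\sin kt),$$ and for a trigonometric polynomial $g$ let $\mu(g)=\mathrm{mes}\{t\in[0,2\pi]:\ |g(t)|\ge 1\}$, where $\mathrm{mes}$ is Lebesgue measure. Then the least constant $\beta_n$ for which the inequality $$\mu(a_n\cos nt+b_n\sin nt)\le \beta_n\,\mu(f_n)$$ holds for all real trigonometric polynomials $f_n$ of the above form is $$\beta_n=\sqrt{2n}.$$ -/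

import Mathlib

open MeasureTheory

noncomputable section

namespace Babenko

/-- The real trigonometric polynomial `a₀ / 2 + ∑_{k=1}^n (a_k cos kt + b_k sin kt)` of order `n`
with coefficients `a`, `b` (only `a 0, …, a n` and `b 1, …, b n` matter). -/
def trigPoly (n : ℕ) (a b : ℕ → ℝ) (t : ℝ) : ℝ :=
  a 0 / 2 + ∑ k ∈ Finset.Icc 1 n, (a k * Real.cos (k * t) + b k * Real.sin (k * t))

/-- The harmonic `a_n cos nt + b_n sin nt` of order `n`. -/
def harmonic (n : ℕ) (a b : ℕ → ℝ) (t : ℝ) : ℝ :=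
  a n * Real.cos (n * t) + b n * Real.sin (n * t)

/-- The Lebesgue measure of the set of points `t` of the period `[0, 2π]` with `|f t| ≥ 1`. -/
def mu (f : ℝ → ℝ) : ℝ :=
  volume.real {t : ℝ | t ∈ Set.Icc 0 (2 * Real.pi) ∧ 1 ≤ |f t|}

/-- The set of constants `β` for which `μ(a_n cos nt + b_n sin nt) ≤ β μ(f_n)` holds for every
real trigonometric polynomial `f_n` of order `n`. -/
def admissibleConstants (n : ℕ) : Set ℝ :=
  {β : ℝ | ∀ a b : ℕ → ℝ, mu (harmonic n a b) ≤ β * mu (trigPoly n a b)}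

end Babenko

end

namespace Babenko

open Real Filter Topology

/-- The mean value over the period `[0, 2π]`. -/
noncomputable def mean (v : ℝ → ℝ) : ℝ := (2 * π)⁻¹ * ∫ s in (0 : ℝ)..2 * π, v s

/-- The Poisson kernel of the unit disc as a function of the cosine of the angle. -/
noncomputable def cosKernel (r x : ℝ) : ℝ := (1 - r ^ 2) / (1 - 2 * r * x + r ^ 2)

/-- The Poisson integral of `v` at the point `r e^{it}`. -/
noncomputable def poisson (r : ℝ) (v : ℝ → ℝ) (t : ℝ) : ℝ :=
  mean fun s => cosKernel r (cos (t - s)) * v s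

lemma mean_const (c : ℝ) : mean (fun _ => c) = c := by
  unfold mean
  simp
  field_simp

lemma mean_add {v w : ℝ → ℝ} (hv : Continuous v) (hw : Continuous w) :
    mean (fun t => v t + w t) = mean v + mean w := by
  unfold mean
  rw [intervalIntegral.integral_add (hv.intervalIntegrable _ _) (hw.intervalIntegrable _ _)]
  ring

lemma mean_const_mul (c : ℝ) (v : ℝ → ℝ) : mean (fun t => c * v t) = c * mean v := by
  unfold mean
  rw [intervalIntegral.integral_const_mul]
  ring

lemma mean_mono {v w : ℝ → ℝ} (hv : Continuous v) (hw : Continuous w) (h : ∀ t, v t ≤ w t) :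
    mean v ≤ mean w := by
  unfold mean
  gcongr
  exact intervalIntegral.integral_mono (by positivity) (hv.intervalIntegrable _ _)
    (hw.intervalIntegrable _ _) h

lemma cosKernel_den_pos {r x : ℝ} (hr : 0 < r) (hr1 : r < 1) (hx : x ≤ 1) :
    0 < 1 - 2 * r * x + r ^ 2 := by
  nlinarith [mul_le_mul_of_nonneg_left hx hr.le, sq_pos_of_pos (sub_pos.2 hr1)]

lemma cosKernel_nonneg {r x : ℝ} (hr : 0 < r) (hr1 : r < 1) (hx : x ≤ 1) :
    0 ≤ cosKernel r x :=
  div_nonneg (by nlinarith) (cosKernel_den_pos hr hr1 hx).le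

lemma cosKernel_mono {r x y : ℝ} (hr : 0 < r) (hr1 : r < 1) (hxy : x ≤ y) (hy : y ≤ 1) :
    cosKernel r x ≤ cosKernel r y := by
  unfold cosKernel
  have h1 := cosKernel_den_pos hr hr1 hy
  have h2 : 0 ≤ 1 - r ^ 2 := by nlinarith
  gcongr

lemma continuous_cosKernel_cos {r : ℝ} (hr : 0 < r) (hr1 : r < 1) :
    Continuous fun p : ℝ × ℝ => cosKernel r (cos (p.1 - p.2)) := by
  unfold cosKernel
  refine Continuous.div (by fun_prop) (by fun_prop) fun p => ?_
  exact (cosKernel_den_pos hr hr1 (cos_le_one _)).ne'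

lemma continuous_poisson_integrand {r : ℝ} (hr : 0 < r) (hr1 : r < 1) {v : ℝ → ℝ}
    (hv : Continuous v) (t : ℝ) : Continuous fun s => cosKernel r (cos (t - s)) * v s :=
  ((continuous_cosKernel_cos hr hr1).comp (by fun_prop : Continuous fun s : ℝ => (t, s))).mul hv

lemma poisson_add {r : ℝ} (hr : 0 < r) (hr1 : r < 1) {v w : ℝ → ℝ} (hv : Continuous v)
    (hw : Continuous w) (t : ℝ) :
    poisson r (fun t => v t + w t) t = poisson r v t + poisson r w t := by
  unfold poisson
  simp only [mul_add]
  exact mean_add (continuous_poisson_integrand hr hr1 hv t)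
    (continuous_poisson_integrand hr hr1 hw t)

lemma poisson_const_mul (r c : ℝ) (v : ℝ → ℝ) (t : ℝ) :
    poisson r (fun t => c * v t) t = c * poisson r v t := by
  unfold poisson
  rw [← mean_const_mul]
  congr 1
  ext s
  ring

lemma poisson_mono {r : ℝ} (hr : 0 < r) (hr1 : r < 1) {v w : ℝ → ℝ} (hv : Continuous v)
    (hw : Continuous w) (h : ∀ t, v t ≤ w t) (t : ℝ) : poisson r v t ≤ poisson r w t :=
  mean_mono (continuous_poisson_integrand hr hr1 hv t) (continuous_poisson_integrand hr hr1 hw t)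
    fun s => mul_le_mul_of_nonneg_left (h s) (cosKernel_nonneg hr hr1 (cos_le_one _))

lemma norm_exp_mul_I_sub_sq (r t s : ℝ) :
    ‖Complex.exp (s * Complex.I) - r * Complex.exp (t * Complex.I)‖ ^ 2
      = 1 - 2 * r * cos (t - s) + r ^ 2 := by
  rw [← Complex.normSq_eq_norm_sq, Complex.normSq_apply]
  simp [Complex.exp_ofReal_mul_I_re, Complex.exp_ofReal_mul_I_im, cos_sub]
  nlinarith [sin_sq_add_cos_sq s, sin_sq_add_cos_sq t]

lemma poisson_of_harmonic {r : ℝ} (hr : 0 < r) (hr1 : r < 1) {h : ℂ → ℝ}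
    (hh : InnerProductSpace.HarmonicOnNhd h (Metric.closedBall 0 1)) (t : ℝ) :
    poisson r (fun s => h (Complex.exp (s * Complex.I))) t
      = h (r * Complex.exp (t * Complex.I)) := by
  have hn : ‖(r : ℂ) * Complex.exp (t * Complex.I)‖ = r := by
    rw [norm_mul, Complex.norm_exp_ofReal_mul_I, mul_one, Complex.norm_real, Real.norm_eq_abs,
      abs_of_pos hr]
  have hw : (r : ℂ) * Complex.exp (t * Complex.I) ∈ Metric.ball (0 : ℂ) 1 := by
    rw [mem_ball_zero_iff, hn]
    exact hr1
  rw [← hh.circleAverage_poissonKernel_smul hw]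
  unfold poisson mean Real.circleAverage
  rw [smul_eq_mul]
  congr 1
  refine intervalIntegral.integral_congr fun s _ => ?_
  simp only [Pi.smul_apply', smul_eq_mul, circleMap, poissonKernel_def, sub_zero, zero_add,
    Complex.ofReal_one, one_mul, hn, Complex.norm_exp_ofReal_mul_I, norm_exp_mul_I_sub_sq,
    cosKernel]
  norm_num

lemma poisson_const {r : ℝ} (hr : 0 < r) (hr1 : r < 1) (c t : ℝ) :
    poisson r (fun _ => c) t = c :=
  poisson_of_harmonic (h := fun _ => c) hr hr1 (fun _ _ => InnerProductSpace.harmonicAt_const c) t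

lemma poisson_log_norm_sub {r : ℝ} (hr : 0 < r) (hr1 : r < 1) {z : ℂ} (hz : 1 < ‖z‖) (t : ℝ) :
    poisson r (fun s => log ‖Complex.exp (s * Complex.I) - z‖) t
      = log ‖r * Complex.exp (t * Complex.I) - z‖ := by
  refine poisson_of_harmonic (h := fun x => log ‖x - z‖) hr hr1 (fun x hx => ?_) t
  refine AnalyticAt.harmonicAt_log_norm (by fun_prop) ?_
  rw [mem_closedBall_zero_iff] at hx
  intro h
  rw [sub_eq_zero] at h
  rw [h] at hx
  linarith

lemma exp_mul_I_sub_ne_zero {z : ℂ} (hz : ‖z‖ ≠ 1) (t : ℝ) :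
    Complex.exp (t * Complex.I) - z ≠ 0 := by
  intro h
  rw [sub_eq_zero] at h
  exact hz (by rw [← h, Complex.norm_exp_ofReal_mul_I])

lemma continuous_log_norm_sub {z : ℂ} (hz : ‖z‖ ≠ 1) :
    Continuous fun t : ℝ => log ‖Complex.exp (t * Complex.I) - z‖ :=
  Continuous.log (by fun_prop) fun t => norm_ne_zero_iff.2 (exp_mul_I_sub_ne_zero hz t)

/-- A point inside the circle may be reflected to the outside. -/
lemma norm_sub_eq_of_inv_conj {z : ℂ} (hz : z ≠ 0) (t : ℝ) :
    ‖Complex.exp (t * Complex.I) - z‖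
      = ‖z‖ * ‖Complex.exp (t * Complex.I) - (starRingEnd ℂ z)⁻¹‖ := by
  have h1 : starRingEnd ℂ (Complex.exp (t * Complex.I)) * Complex.exp (t * Complex.I) = 1 := by
    rw [mul_comm, Complex.mul_conj, Complex.normSq_eq_norm_sq, Complex.norm_exp_ofReal_mul_I]
    simp
  have h2 : starRingEnd ℂ z ≠ 0 := by simpa using hz
  rw [← Complex.norm_conj z, ← norm_mul, mul_sub, mul_inv_cancel₀ h2, ← h1, ← sub_mul, norm_mul,
    Complex.norm_exp_ofReal_mul_I, mul_one, ← map_sub, Complex.norm_conj, norm_sub_rev]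

lemma log_norm_sub_sub_poisson_le {r : ℝ} (hr : 0 < r) (hr1 : r < 1) {z : ℂ} (hz : ‖z‖ ≠ 1)
    (t : ℝ) :
    log ‖Complex.exp (t * Complex.I) - z‖
      - poisson r (fun s => log ‖Complex.exp (s * Complex.I) - z‖) t ≤ 1 / 2 * log (1 / r) := by
  have hL : 0 ≤ log (1 / r) := log_nonneg (by rw [le_div_iff₀ hr]; linarith)
  have main : ∀ z : ℂ, 1 < ‖z‖ → log ‖Complex.exp (t * Complex.I) - z‖
      - poisson r (fun s => log ‖Complex.exp (s * Complex.I) - z‖) t ≤ 1 / 2 * log (1 / r) := by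
    intro z hz
    rw [poisson_log_norm_sub hr hr1 hz]
    have h0 : 0 < ‖Complex.exp (t * Complex.I) - z‖ :=
      norm_pos_iff.2 (exp_mul_I_sub_ne_zero hz.ne' t)
    have hle : r * ‖Complex.exp (t * Complex.I) - z‖ ^ 2
        ≤ ‖r * Complex.exp (t * Complex.I) - z‖ ^ 2 := by
      have hz2 : 1 ≤ z.re * z.re + z.im * z.im := by
        rw [← Complex.normSq_apply, Complex.normSq_eq_norm_sq]
        nlinarith
      simp only [← Complex.normSq_eq_norm_sq, Complex.normSq_apply, Complex.sub_re,
        Complex.sub_im, Complex.re_ofReal_mul, Complex.im_ofReal_mul,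
        Complex.exp_ofReal_mul_I_re, Complex.exp_ofReal_mul_I_im]
      have := sin_sq_add_cos_sq t
      rw [← sub_nonneg]
      refine (mul_nonneg (sub_nonneg.2 hr1.le) (sub_nonneg.2 (hr1.le.trans hz2))).trans_eq ?_
      linear_combination (r - r ^ 2) * this
    have := log_le_log (by positivity) hle
    rw [log_mul hr.ne' (by positivity), log_pow, log_pow] at this
    rw [one_div r, log_inv]
    push_cast at this
    linarith
  rcases lt_or_gt_of_ne hz with h | h
  · by_cases hz0 : z = 0
    · simp only [hz0, sub_zero, Complex.norm_exp_ofReal_mul_I, log_one]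
      rw [poisson_const hr hr1]
      linarith
    · have hp : 0 < ‖z‖ := norm_pos_iff.2 hz0
      have h' : 1 < ‖(starRingEnd ℂ z)⁻¹‖ := by
        rw [norm_inv, Complex.norm_conj]
        exact (one_lt_inv₀ hp).2 h
      have e : ∀ s : ℝ, log ‖Complex.exp (s * Complex.I) - z‖
          = log ‖z‖ + log ‖Complex.exp (s * Complex.I) - (starRingEnd ℂ z)⁻¹‖ := fun s => by
        rw [norm_sub_eq_of_inv_conj hz0, log_mul hp.ne'
          (norm_ne_zero_iff.2 (exp_mul_I_sub_ne_zero h'.ne' s))]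
      simp only [e]
      rw [poisson_add hr hr1 continuous_const (continuous_log_norm_sub h'.ne'),
        poisson_const hr hr1]
      linarith [main _ h']
  · exact main z h

lemma mean_log_norm_sub (z : ℂ) :
    mean (fun t => log ‖Complex.exp (t * Complex.I) - z‖) = posLog ‖z‖ := by
  rw [← circleAverage_log_norm_sub_const_eq_posLog]
  simp [mean, Real.circleAverage, circleMap]

end Babenko

namespace Babenko

open Real Filter Topology

section MultisetSum

variable {α : Type*}

lemma continuous_multiset_map_sum (W : Multiset α) {F : α → ℝ → ℝ}
    (hF : ∀ w ∈ W, Continuous (F w)) : Continuous fun t => (W.map fun w => F w t).sum := by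
  induction W using Multiset.induction_on with
  | empty => simpa using continuous_const
  | cons a s ih =>
    simp only [Multiset.map_cons, Multiset.sum_cons]
    exact (hF a (by simp)).add (ih fun w hw => hF w (by simp [hw]))

lemma mean_multiset_map_sum (W : Multiset α) {F : α → ℝ → ℝ} (hF : ∀ w ∈ W, Continuous (F w)) :
    mean (fun t => (W.map fun w => F w t).sum) = (W.map fun w => mean (F w)).sum := by
  induction W using Multiset.induction_on with
  | empty => simpa using mean_const 0
  | cons a s ih =>
    simp only [Multiset.map_cons, Multiset.sum_cons]
    rw [mean_add (hF a (by simp)) (continuous_multiset_map_sum s fun w hw => hF w (by simp [hw])),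
      ih fun w hw => hF w (by simp [hw])]

lemma poisson_multiset_map_sum {r : ℝ} (hr : 0 < r) (hr1 : r < 1) (W : Multiset α)
    {F : α → ℝ → ℝ} (hF : ∀ w ∈ W, Continuous (F w)) (t : ℝ) :
    poisson r (fun t => (W.map fun w => F w t).sum) t
      = (W.map fun w => poisson r (F w) t).sum := by
  induction W using Multiset.induction_on with
  | empty => simpa using poisson_const hr hr1 0 t
  | cons a s ih =>
    simp only [Multiset.map_cons, Multiset.sum_cons]
    rw [poisson_add hr hr1 (hF a (by simp))
      (continuous_multiset_map_sum s fun w hw => hF w (by simp [hw])),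
      ih fun w hw => hF w (by simp [hw])]

lemma log_norm_multiset_prod (Z : Multiset ℂ) {x : ℂ} (hx : ∀ z ∈ Z, x - z ≠ 0) :
    log ‖(Z.map fun z => x - z).prod‖ = (Z.map fun z => log ‖x - z‖).sum := by
  induction Z using Multiset.induction_on with
  | empty => simp
  | cons a s ih =>
    simp only [Multiset.map_cons, Multiset.sum_cons, Multiset.prod_cons]
    have h1 : (s.map fun z => x - z).prod ≠ 0 := by
      refine Multiset.prod_ne_zero fun h => ?_
      obtain ⟨z, hz, h0⟩ := Multiset.mem_map.1 h
      exact hx z (by simp [hz]) h0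
    rw [norm_mul, log_mul (norm_ne_zero_iff.2 (hx a (by simp))) (norm_ne_zero_iff.2 h1),
      ih fun w hw => hx w (by simp [hw])]

end MultisetSum

/-- A continuous function with mean at least `c` which the Poisson average at radius `r` lowers
by at most `N log (1 / r)`. -/
structure IsLogPot (N c : ℝ) (v : ℝ → ℝ) : Prop where
  continuous : Continuous v
  le_mean : c ≤ mean v
  sub_poisson_le : ∀ r, 0 < r → r < 1 → ∀ t, v t - poisson r v t ≤ N * log (1 / r)

lemma IsLogPot.const (c : ℝ) : IsLogPot 0 c fun _ => c where
  continuous := continuous_const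
  le_mean := (mean_const c).ge
  sub_poisson_le r hr hr1 t := by rw [poisson_const hr hr1]; simp

lemma IsLogPot.add {N N' c c' : ℝ} {v v' : ℝ → ℝ} (h : IsLogPot N c v) (h' : IsLogPot N' c' v') :
    IsLogPot (N + N') (c + c') fun t => v t + v' t where
  continuous := h.continuous.add h'.continuous
  le_mean := by
    rw [mean_add h.continuous h'.continuous]
    exact add_le_add h.le_mean h'.le_mean
  sub_poisson_le r hr hr1 t := by
    rw [poisson_add hr hr1 h.continuous h'.continuous]
    linarith [h.sub_poisson_le r hr hr1 t, h'.sub_poisson_le r hr hr1 t]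

lemma IsLogPot.const_mul {N c k : ℝ} {v : ℝ → ℝ} (h : IsLogPot N c v) (hk : 0 ≤ k) :
    IsLogPot (k * N) (k * c) fun t => k * v t where
  continuous := continuous_const.mul h.continuous
  le_mean := by
    rw [mean_const_mul]
    exact mul_le_mul_of_nonneg_left h.le_mean hk
  sub_poisson_le r hr hr1 t := by
    rw [poisson_const_mul, ← mul_sub, mul_assoc]
    exact mul_le_mul_of_nonneg_left (h.sub_poisson_le r hr hr1 t) hk

lemma IsLogPot.multiset_sum {α : Type*} {N c : ℝ} (W : Multiset α) {F : α → ℝ → ℝ}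
    (hF : ∀ w ∈ W, IsLogPot N c (F w)) :
    IsLogPot (W.card * N) (W.card * c) fun t => (W.map fun w => F w t).sum := by
  induction W using Multiset.induction_on with
  | empty => simpa using IsLogPot.const 0
  | cons a s ih =>
    simp only [Multiset.map_cons, Multiset.sum_cons, Multiset.card_cons, Nat.cast_add,
      Nat.cast_one, add_mul, one_mul]
    rw [add_comm _ N, add_comm _ c]
    exact (hF a (by simp)).add (ih fun w hw => hF w (by simp [hw]))

lemma isLogPot_log_norm_sub {z : ℂ} (hz : ‖z‖ ≠ 1) :
    IsLogPot (1 / 2) 0 fun t => log ‖Complex.exp (t * Complex.I) - z‖ where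
  continuous := continuous_log_norm_sub hz
  le_mean := by rw [mean_log_norm_sub]; exact posLog_nonneg
  sub_poisson_le r hr hr1 t := log_norm_sub_sub_poisson_le hr hr1 hz t

section TrigPoly

open Polynomial

/-- The algebraic polynomial `z ^ n (f(z) - w)` of degree `2n`, where `f(e^{it})` is the
trigonometric polynomial of order `n` with coefficients `a`, `b`. -/
noncomputable def algPoly (n : ℕ) (a b : ℕ → ℝ) (w : ℂ) : ℂ[X] :=
  C ((a 0 : ℂ) / 2 - w) * X ^ n + ∑ k ∈ Finset.Icc 1 n,
    (C (((a k : ℂ) - b k * Complex.I) / 2) * X ^ (n + k)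
      + C (((a k : ℂ) + b k * Complex.I) / 2) * X ^ (n - k))

lemma eval_algPoly (n : ℕ) (a b : ℕ → ℝ) (w : ℂ) (t : ℝ) :
    (algPoly n a b w).eval (Complex.exp (t * Complex.I))
      = Complex.exp (t * Complex.I) ^ n * (trigPoly n a b t - w) := by
  have key : ∀ k ∈ Finset.Icc 1 n,
      ((a k : ℂ) - b k * Complex.I) / 2 * Complex.exp (t * Complex.I) ^ (n + k)
        + ((a k : ℂ) + b k * Complex.I) / 2 * Complex.exp (t * Complex.I) ^ (n - k)
      = Complex.exp (t * Complex.I) ^ n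
        * ((a k * Real.cos (k * t) + b k * Real.sin (k * t) : ℝ) : ℂ) := by
    intro k hk
    have hkn := (Finset.mem_Icc.1 hk).2
    have h1 : Complex.exp (t * Complex.I) ^ n
        = Complex.exp (t * Complex.I) ^ (n - k) * Complex.exp (t * Complex.I) ^ k := by
      rw [← pow_add, Nat.sub_add_cancel hkn]
    have h2 : Complex.exp (t * Complex.I) ^ k
        = Complex.cos (k * t) + Complex.sin (k * t) * Complex.I := by
      rw [← Complex.exp_nat_mul, ← Complex.exp_mul_I]
      ring_nf
    rw [pow_add, h1, h2]
    push_cast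
    have h3 := Complex.sin_sq_add_cos_sq (k * t : ℂ)
    linear_combination (Complex.exp (t * Complex.I)) ^ (n - k) * (((a k : ℂ) + b k * Complex.I) / 2 * (-h3)
      + (-b k * Complex.cos (k * t) * Complex.sin (k * t) + (a k : ℂ) / 2 * Complex.sin (k * t) ^ 2  - b k / 2 * Complex.I * Complex.sin (k * t) ^ 2) * Complex.I_sq)
  unfold algPoly trigPoly
  rw [eval_add, eval_finsetSum]
  simp only [eval_add, eval_mul, eval_C, eval_pow, eval_X]
  rw [Finset.sum_congr rfl key, ← Finset.mul_sum]
  push_cast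
  ring

lemma coeff_algPoly {n : ℕ} (hn : 1 ≤ n) (a b : ℕ → ℝ) (w : ℂ) :
    (algPoly n a b w).coeff (2 * n) = ((a n : ℂ) - b n * Complex.I) / 2 := by
  unfold algPoly
  rw [coeff_add, finsetSum_coeff, Finset.sum_eq_single n]
  · simp only [coeff_add, coeff_C_mul, coeff_X_pow]
    rw [if_neg (by omega), if_pos (by omega), if_neg (by omega)]
    simp
  · intro k hk hkn
    rw [Finset.mem_Icc] at hk
    simp only [coeff_add, coeff_C_mul, coeff_X_pow]
    rw [if_neg (by omega), if_neg (by omega)]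
    simp
  · intro h
    exact absurd (Finset.mem_Icc.2 ⟨hn, le_rfl⟩) h

lemma natDegree_algPoly_le (n : ℕ) (a b : ℕ → ℝ) (w : ℂ) :
    (algPoly n a b w).natDegree ≤ 2 * n := by
  unfold algPoly
  refine natDegree_add_le_of_degree_le ((natDegree_C_mul_X_pow_le _ _).trans (by omega)) ?_
  refine natDegree_sum_le_of_forall_le _ _ fun k hk => ?_
  rw [Finset.mem_Icc] at hk
  exact natDegree_add_le_of_degree_le ((natDegree_C_mul_X_pow_le _ _).trans (by omega))
    ((natDegree_C_mul_X_pow_le _ _).trans (by omega))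

lemma norm_sub_mul_I (x y : ℝ) : ‖(x : ℂ) - y * Complex.I‖ = √(x ^ 2 + y ^ 2) := by
  rw [Complex.norm_def, Complex.normSq_apply]
  simp
  ring_nf

/-- The logarithm of the modulus of a shifted trigonometric polynomial as a sum over zeros. -/
lemma exists_log_norm_trigPoly_sub {n : ℕ} (hn : 1 ≤ n) {a b : ℕ → ℝ}
    (hA : 0 < √(a n ^ 2 + b n ^ 2)) {w : ℂ} (hw : w.im ≠ 0) :
    ∃ Z : Multiset ℂ, Z.card = 2 * n ∧ (∀ z ∈ Z, ‖z‖ ≠ 1) ∧ ∀ t : ℝ,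
      log ‖(trigPoly n a b t : ℂ) - w‖ = log (√(a n ^ 2 + b n ^ 2) / 2)
        + (Z.map fun z => log ‖Complex.exp (t * Complex.I) - z‖).sum := by
  set p := algPoly n a b w with hp
  have hcoeff : ‖p.coeff (2 * n)‖ = √(a n ^ 2 + b n ^ 2) / 2 := by
    rw [coeff_algPoly hn, norm_div, norm_sub_mul_I]
    simp
  have hdeg : p.natDegree = 2 * n := by
    refine le_antisymm (natDegree_algPoly_le n a b w) (le_natDegree_of_ne_zero fun h => ?_)
    rw [h, norm_zero] at hcoeff
    linarith
  have hsplit := IsAlgClosed.splits p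
  have hne : ∀ t : ℝ, (trigPoly n a b t : ℂ) - w ≠ 0 := fun t h => hw (by
    rw [← sub_eq_zero.1 h, Complex.ofReal_im])
  have hroot : ∀ z ∈ p.roots, ‖z‖ ≠ 1 := by
    intro z hz h1
    have h0 : p.eval z = 0 := (mem_roots'.1 hz).2
    have hz' : z = Complex.exp (z.arg * Complex.I) := by
      conv_lhs => rw [← Complex.norm_mul_exp_arg_mul_I z, h1]
      simp
    rw [hz', hp, eval_algPoly] at h0
    exact mul_ne_zero (pow_ne_zero _ (Complex.exp_ne_zero _)) (hne _) h0
  refine ⟨p.roots, by rw [← hsplit.natDegree_eq_card_roots, hdeg], hroot, fun t => ?_⟩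
  have hx : ∀ z ∈ p.roots, Complex.exp (t * Complex.I) - z ≠ 0 := fun z hz =>
    exp_mul_I_sub_ne_zero (hroot z hz) t
  rw [← log_norm_multiset_prod _ hx, ← hcoeff, ← hdeg, ← log_mul, ← norm_mul]
  · have h := eval_algPoly n a b w t
    rw [← hp, hsplit.eval_eq_prod_roots] at h
    rw [coeff_natDegree, h, norm_mul, norm_pow, Complex.norm_exp_ofReal_mul_I, one_pow, one_mul]
  · rw [hdeg, hcoeff]; exact (by positivity)
  · refine norm_ne_zero_iff.2 (Multiset.prod_ne_zero fun h => ?_)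
    obtain ⟨z, hz, h0⟩ := Multiset.mem_map.1 h
    exact hx z hz h0

lemma isLogPot_log_norm_trigPoly_sub {n : ℕ} (hn : 1 ≤ n) {a b : ℕ → ℝ}
    (hA : 0 < √(a n ^ 2 + b n ^ 2)) {w : ℂ} (hw : w.im ≠ 0) :
    IsLogPot n (log (√(a n ^ 2 + b n ^ 2) / 2)) fun t => log ‖(trigPoly n a b t : ℂ) - w‖ := by
  obtain ⟨Z, hZ, hZ1, hlog⟩ := exists_log_norm_trigPoly_sub hn hA hw
  have h := (IsLogPot.const (log (√(a n ^ 2 + b n ^ 2) / 2))).add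
    (IsLogPot.multiset_sum Z fun z hz => isLogPot_log_norm_sub (hZ1 z hz))
  simp only [← hlog, hZ] at h
  convert h using 1
  · push_cast; ring
  · ring

end TrigPoly

end Babenko

namespace Babenko

open Real Filter Topology Polynomial

/-- The boundary values of the Green function of the complement of `[-1, 1]`. -/
noncomputable def green (x : ℝ) : ℝ := arcosh (max 1 |x|)

lemma green_nonneg (x : ℝ) : 0 ≤ green x := arcosh_nonneg (le_max_left 1 |x|)

lemma green_eq_zero {x : ℝ} (hx : |x| ≤ 1) : green x = 0 := by
  rw [green, max_eq_left hx, arcosh_eq_zero_iff le_rfl]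

lemma continuous_green : Continuous green := by
  refine continuousOn_arcosh.comp_continuous (by fun_prop) fun x => ?_
  exact le_max_left (1 : ℝ) |x|

lemma eval_T_bounds (m : ℕ) (x : ℝ) :
    |(Chebyshev.T ℝ m).eval x| ≤ exp (m * green x)
      ∧ exp (m * green x) ≤ 2 * |(Chebyshev.T ℝ m).eval x| + 1 := by
  rcases le_total |x| 1 with h | h
  · rw [green_eq_zero h]
    simpa using Chebyshev.abs_eval_T_real_le_one m h
  · have hx : |(Chebyshev.T ℝ m).eval x| = cosh (m * green x) := by
      have hc : cosh (green x) = |x| := by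
        rw [green, max_eq_right h, cosh_arcosh h]
      have habs : |(Chebyshev.T ℝ m).eval x| = |(Chebyshev.T ℝ m).eval (|x|)| := by
        rcases abs_choice x with h1 | h1
        · rw [h1]
        · rw [h1, Chebyshev.T_eval_neg, abs_mul]
          simp
      rw [habs, ← hc, Chebyshev.T_real_cosh]
      simp [abs_of_pos (cosh_pos _)]
    have hg : 0 ≤ (m : ℝ) * green x := mul_nonneg (by positivity) (green_nonneg x)
    have h1 := exp_le_one_iff.2 (neg_nonpos.2 hg)
    have h2 := one_le_exp hg
    rw [hx, cosh_eq]
    have h3 := exp_pos (-(m * green x))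
    constructor <;> linarith

lemma norm_T_sub_I (m : ℕ) (x : ℝ) :
    ‖(Chebyshev.T ℂ m).eval (x : ℂ) - Complex.I‖
      = √((Chebyshev.T ℝ m).eval x ^ 2 + 1) := by
  rw [← Chebyshev.complex_ofReal_eval_T]
  simpa using norm_sub_mul_I ((Chebyshev.T ℝ m).eval x) 1

/-- `log |T_m - i| / m` approximates the Green function on the real line. -/
lemma abs_log_norm_T_sub_I_sub_le {m : ℕ} (hm : 1 ≤ m) (x : ℝ) :
    |(1 / m : ℝ) * log ‖(Chebyshev.T ℂ m).eval (x : ℂ) - Complex.I‖ - green x|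
      ≤ 2 / m := by
  have hm' : (0 : ℝ) < m := by exact_mod_cast hm
  obtain ⟨h1, h2⟩ := eval_T_bounds m x
  rw [norm_T_sub_I]
  set τ := (Chebyshev.T ℝ m).eval x
  set ρ := exp (m * green x) with hρ
  have hρ1 : 1 ≤ ρ := one_le_exp (mul_nonneg hm'.le (green_nonneg x))
  have ha := abs_nonneg τ
  have hup : √(τ ^ 2 + 1) ≤ exp 2 * ρ := by
    have he : (2 : ℝ) ≤ exp 2 := by linarith [add_one_le_exp (2 : ℝ)]
    refine (sqrt_le_iff.2 ⟨by positivity, ?_⟩ : √(τ ^ 2 + 1) ≤ 2 * ρ).trans (by gcongr)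
    rw [← sq_abs τ]
    nlinarith
  have hlow : exp (-2) * ρ ≤ √(τ ^ 2 + 1) := by
    refine le_sqrt_of_sq_le ?_
    have he : exp (-2) ≤ 1 / 3 := by
      rw [exp_neg, inv_eq_one_div]
      exact one_div_le_one_div_of_le (by norm_num) (by linarith [add_one_le_exp (2 : ℝ)])
    have : exp (-2) * ρ ≤ 1 / 3 * ρ := by gcongr
    have h0 : 0 ≤ exp (-2) * ρ := by positivity
    rw [← sq_abs τ]
    nlinarith [sq_nonneg (|τ| - 1)]
  have hs : 0 < √(τ ^ 2 + 1) := by positivity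
  have l1 := log_le_log hs hup
  have l2 := log_le_log (by positivity) hlow
  rw [log_mul (by positivity) (by positivity), log_exp, hρ, log_exp] at l1 l2
  have e : (1 / m : ℝ) * log √(τ ^ 2 + 1) - green x
      = (log √(τ ^ 2 + 1) - m * green x) / m := by field_simp
  rw [e, abs_div, abs_of_pos hm']
  gcongr
  rw [abs_le]
  constructor <;> linarith

/-- The zeros of `T_m - i`, in Joukowski coordinates. -/
lemma exists_roots_T_sub_I {m : ℕ} (hm : 1 ≤ m) :
    ∃ W : Multiset ℂ, W.card = m
      ∧ (∀ w ∈ W, w.im ≠ 0 ∧ ∃ b : ℂ, 1 ≤ ‖b‖ ∧ ‖b‖ ^ m ≤ 3 ∧ w = (b + b⁻¹) / 2)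
      ∧ ∀ x : ℝ, log ‖(Chebyshev.T ℂ m).eval (x : ℂ) - Complex.I‖
        = (m - 1) * log 2 + (W.map fun w => log ‖(x : ℂ) - w‖).sum := by
  set p := Chebyshev.T ℂ m - C Complex.I with hp
  have hdeg : p.natDegree = m := by rw [hp, natDegree_sub_C, Chebyshev.natDegree_T]; simp
  have hlead : p.leadingCoeff = 2 ^ (m - 1) := by
    rw [hp, leadingCoeff_sub_of_degree_lt, Chebyshev.leadingCoeff_T]
    · simp
    · rw [Chebyshev.degree_T]
      refine degree_C_le.trans_lt ?_
      exact_mod_cast hm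
  have hsplit := IsAlgClosed.splits p
  have him : ∀ w ∈ p.roots, w.im ≠ 0 := by
    intro w hw h0
    have h : p.eval w = 0 := (mem_roots'.1 hw).2
    have hw' : w = (w.re : ℂ) := Complex.ext (by simp) (by simp [h0])
    rw [hw', hp, eval_sub, eval_C, ← Chebyshev.complex_ofReal_eval_T] at h
    have h' := congrArg Complex.im h
    rw [Complex.sub_im, Complex.ofReal_im, Complex.I_im] at h'
    norm_num at h'
  refine ⟨p.roots, by rw [← hsplit.natDegree_eq_card_roots, hdeg], fun w hw => ⟨him w hw, ?_⟩,
    fun x => ?_⟩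
  · have h : p.eval w = 0 := (mem_roots'.1 hw).2
    obtain ⟨θ, rfl⟩ := Complex.cos_surjective w
    rw [hp, eval_sub, eval_C, Chebyshev.T_complex_cos, sub_eq_zero] at h
    have key : ∀ θ : ℂ, Complex.cos (m * θ) = Complex.I → 1 ≤ ‖Complex.exp (θ * Complex.I)‖ →
        ‖Complex.exp (θ * Complex.I)‖ ^ m ≤ 3 := by
      intro θ h hb
      rw [← norm_pow, ← Complex.exp_nat_mul, ← mul_assoc]
      set B := Complex.exp (m * θ * Complex.I) with hB
      have hB1 : 1 ≤ ‖B‖ := by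
        rw [hB, mul_assoc, Complex.exp_nat_mul, norm_pow]
        exact one_le_pow₀ hb
      have e : B = 2 * Complex.I - B⁻¹ := by
        rw [← h, Complex.cos, hB, ← Complex.exp_neg]
        ring_nf
      calc ‖B‖ = ‖2 * Complex.I - B⁻¹‖ := by rw [← e]
        _ ≤ ‖2 * Complex.I‖ + ‖B⁻¹‖ := norm_sub_le _ _
        _ ≤ 2 + 1 := by
          gcongr
          · simp
          · rw [norm_inv]
            exact inv_le_one_of_one_le₀ hB1
        _ = 3 := by norm_num
    rcases le_total 1 ‖Complex.exp (θ * Complex.I)‖ with hb | hb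
    · refine ⟨Complex.exp (θ * Complex.I), hb, key θ (by exact_mod_cast h) hb, ?_⟩
      rw [Complex.cos, ← Complex.exp_neg, neg_mul]
    · have hb' : 1 ≤ ‖Complex.exp (-θ * Complex.I)‖ := by
        rw [neg_mul, Complex.exp_neg, norm_inv]
        exact (one_le_inv₀ (norm_pos_iff.2 (Complex.exp_ne_zero _))).2 hb
      refine ⟨Complex.exp (-θ * Complex.I), hb', key (-θ) ?_ hb', ?_⟩
      · rw [mul_neg, Complex.cos_neg]
        exact_mod_cast h
      · rw [Complex.cos, ← Complex.exp_neg, neg_mul, neg_neg, add_comm]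
  · have hx : ∀ w ∈ p.roots, (x : ℂ) - w ≠ 0 := fun w hw h => him w hw (by
      rw [← sub_eq_zero.1 h, Complex.ofReal_im])
    rw [← log_norm_multiset_prod _ hx]
    have h := hsplit.eval_eq_prod_roots (x : ℂ)
    have h2 : p.eval (x : ℂ) = (Chebyshev.T ℂ m).eval (x : ℂ) - Complex.I := by
      rw [hp, eval_sub, eval_C]
    rw [← h2, h, norm_mul, log_mul, hlead]
    · simp only [norm_pow, Complex.norm_ofNat, log_pow]
      rw [Nat.cast_sub hm, Nat.cast_one]
    · simp [hlead]
    · refine norm_ne_zero_iff.2 (Multiset.prod_ne_zero fun h => ?_)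
      obtain ⟨z, hz, h0⟩ := Multiset.mem_map.1 h
      exact hx z hz h0

lemma continuous_trigPoly (n : ℕ) (a b : ℕ → ℝ) : Continuous (trigPoly n a b) := by
  unfold trigPoly
  fun_prop

/-- Approximation of a function by log potentials. -/
lemma isLogPot_of_approx {N c : ℝ} {v : ℝ → ℝ} (hv : Continuous v) {vm : ℕ → ℝ → ℝ}
    {cm : ℕ → ℝ} (hm : ∀ m, 1 ≤ m → IsLogPot N (cm m) (vm m))
    (hc : Tendsto cm atTop (𝓝 c)) (h : ∀ m : ℕ, 1 ≤ m → ∀ t, |vm m t - v t| ≤ 2 / m) :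
    IsLogPot N c v where
  continuous := hv
  le_mean := by
    have ht : Tendsto (fun m : ℕ => cm m - 2 / (m : ℝ)) atTop (𝓝 (c - 0)) :=
      hc.sub (tendsto_const_div_atTop_nhds_zero_nat 2)
    rw [sub_zero] at ht
    refine le_of_tendsto ht (eventually_atTop.2 ⟨1, fun m h1 => ?_⟩)
    have hle : mean (vm m) ≤ mean fun t => v t + 2 / m :=
      mean_mono (hm m h1).continuous (by fun_prop) fun t => by
        linarith [(abs_le.1 (h m h1 t)).2]
    rw [mean_add hv continuous_const, mean_const] at hle
    linarith [(hm m h1).le_mean]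
  sub_poisson_le r hr hr1 t := by
    have ht : Tendsto (fun m : ℕ => N * log (1 / r) + 2 / (m : ℝ) + 2 / (m : ℝ)) atTop
        (𝓝 (N * log (1 / r) + 0 + 0)) :=
      (tendsto_const_nhds.add (tendsto_const_div_atTop_nhds_zero_nat 2)).add
        (tendsto_const_div_atTop_nhds_zero_nat 2)
    rw [add_zero, add_zero] at ht
    refine ge_of_tendsto ht (eventually_atTop.2 ⟨1, fun m h1 => ?_⟩)
    have hle : poisson r (vm m) t ≤ poisson r (fun t => v t + 2 / m) t :=
      poisson_mono hr hr1 (hm m h1).continuous (by fun_prop) (fun t => by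
        linarith [(abs_le.1 (h m h1 t)).2]) t
    rw [poisson_add hr hr1 hv continuous_const, poisson_const hr hr1] at hle
    linarith [(hm m h1).sub_poisson_le r hr hr1 t, (abs_le.1 (h m h1 t)).1]

lemma tendsto_one_div_mul_sub_one_mul (x : ℝ) :
    Tendsto (fun m : ℕ => (1 / m : ℝ) * ((m - 1) * x)) atTop (𝓝 x) := by
  have h : Tendsto (fun m : ℕ => x - x / (m : ℝ)) atTop (𝓝 (x - 0)) :=
    tendsto_const_nhds.sub (tendsto_const_div_atTop_nhds_zero_nat x)
  rw [sub_zero] at h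
  refine h.congr' (eventually_atTop.2 ⟨1, fun m h1 => ?_⟩)
  have : (0 : ℝ) < m := by exact_mod_cast h1
  field_simp

lemma isLogPot_green_trigPoly {n : ℕ} (hn : 1 ≤ n) {a b : ℕ → ℝ}
    (hA : 0 < √(a n ^ 2 + b n ^ 2)) :
    IsLogPot n (log √(a n ^ 2 + b n ^ 2)) fun t => green (trigPoly n a b t) := by
  set A := √(a n ^ 2 + b n ^ 2)
  refine isLogPot_of_approx (vm := fun m t => (1 / m : ℝ)
      * log ‖(Chebyshev.T ℂ m).eval (trigPoly n a b t : ℂ) - Complex.I‖)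
    (cm := fun m => (1 / m : ℝ) * ((m - 1) * log 2) + log (A / 2))
    (continuous_green.comp (continuous_trigPoly n a b)) (fun m h1 => ?_) ?_
    fun m h1 t => abs_log_norm_T_sub_I_sub_le h1 _
  · obtain ⟨W, hW, hWim, hlog⟩ := exists_roots_T_sub_I h1
    have hm' : (0 : ℝ) < m := by exact_mod_cast h1
    have h := (IsLogPot.const ((m - 1) * log 2)).add
      (IsLogPot.multiset_sum W fun w hw => isLogPot_log_norm_trigPoly_sub hn hA (hWim w hw).1)
    simp only [← hlog, hW] at h
    convert h.const_mul (by positivity : (0 : ℝ) ≤ 1 / m) using 1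
    · field_simp; ring
    · field_simp; rfl
  · have h := (tendsto_one_div_mul_sub_one_mul (log 2)).add_const (log (A / 2))
    rwa [← log_mul (by norm_num) (by positivity), mul_div_cancel₀ A (by norm_num)] at h

end Babenko

namespace Babenko

open Real Filter Topology

/-- The trigonometric polynomial of order one whose set `{|f| > 1}` is an arc. -/
noncomputable def arcPoly (c t : ℝ) : ℝ := (1 + cos t) / c ^ 2 - 1

lemma continuous_arcPoly (c : ℝ) : Continuous (arcPoly c) := by
  unfold arcPoly
  fun_prop

lemma exists_joukowski (y : ℂ) : ∃ a : ℂ, 1 ≤ ‖a‖ ∧ y = (a + a⁻¹) / 2 := by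
  obtain ⟨θ, rfl⟩ := Complex.cos_surjective y
  rcases le_total 1 ‖Complex.exp (θ * Complex.I)‖ with hb | hb
  · refine ⟨Complex.exp (θ * Complex.I), hb, ?_⟩
    rw [Complex.cos, ← Complex.exp_neg, neg_mul]
  · refine ⟨Complex.exp (-θ * Complex.I), ?_, ?_⟩
    · rw [neg_mul, Complex.exp_neg, norm_inv]
      exact (one_le_inv₀ (norm_pos_iff.2 (Complex.exp_ne_zero _))).2 hb
    · rw [Complex.cos, ← Complex.exp_neg, neg_mul, neg_neg, add_comm]

lemma joukowski_focal_sum {a : ℂ} (ha : a ≠ 0) :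
    ‖(a + a⁻¹) / 2 - 1‖ + ‖(a + a⁻¹) / 2 + 1‖ = ‖a‖ + ‖a‖⁻¹ := by
  have e1 : (a + a⁻¹) / 2 - 1 = (a - 1) * (a - 1) / (2 * a) := by field_simp; ring
  have e2 : (a + a⁻¹) / 2 + 1 = (a + 1) * (a + 1) / (2 * a) := by field_simp; ring
  have h := parallelogram_law_with_norm ℝ a 1
  have hp : 0 < ‖a‖ := norm_pos_iff.2 ha
  rw [norm_one] at h
  rw [e1, e2, norm_div, norm_div, norm_mul, norm_mul, norm_mul, Complex.norm_ofNat, ← add_div,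
    ← pow_two, ← pow_two, add_comm, h]
  field_simp

lemma le_of_add_inv_le {x y : ℝ} (hx : 1 ≤ x) (hy : 1 ≤ y) (h : x + x⁻¹ ≤ y + y⁻¹) : x ≤ y := by
  by_contra! hlt
  have hx0 : 0 < x := by linarith
  have hy0 : 0 < y := by linarith
  have h1 : 0 < x * y := mul_pos hx0 hy0
  have h2 := mul_le_mul_of_nonneg_left h h1.le
  have e1 : x * y * (x + x⁻¹) = x * x * y + y := by field_simp
  have e2 : x * y * (y + y⁻¹) = x * y * y + x := by field_simp
  rw [e1, e2] at h2
  nlinarith [mul_pos (sub_pos.2 hlt) (by nlinarith : 0 < x * y - 1)]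

lemma conj_exp_mul_I (t : ℝ) :
    starRingEnd ℂ (Complex.exp (t * Complex.I)) = (Complex.exp (t * Complex.I))⁻¹ := by
  rw [← Complex.exp_conj, ← Complex.exp_neg]
  simp

lemma norm_mul_norm_conj {a y : ℂ} (ha : a ≠ 0) (hy : y = (a + a⁻¹) / 2) (t : ℝ) :
    ‖Complex.exp (t * Complex.I) - a‖ * ‖Complex.exp (t * Complex.I) - starRingEnd ℂ a‖
      = 2 * ‖a‖ * ‖(cos t : ℂ) - y‖ := by
  have h0 := Complex.exp_ne_zero (t * Complex.I)
  have e : (Complex.exp (t * Complex.I) - a)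
      * (starRingEnd ℂ (Complex.exp (t * Complex.I) - starRingEnd ℂ a))
      = -(2 * a * ((cos t : ℂ) - y)) := by
    rw [hy, Complex.ofReal_cos, Complex.cos, map_sub, conj_exp_mul_I, Complex.conj_conj, neg_mul,
      Complex.exp_neg]
    field_simp
    ring
  rw [← Complex.norm_conj (_ - starRingEnd ℂ a), ← norm_mul, e]
  simp

/-- The zeros of `arcPoly c - w` for `w` close to `[-1, 1]` are close to the unit circle. -/
lemma exists_log_norm_arcPoly_sub {c : ℝ} (hc : 0 < c) (hc1 : c ≤ 1) {w b : ℂ} (hw : w.im ≠ 0)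
    (hb : 1 ≤ ‖b‖) (hwb : w = (b + b⁻¹) / 2) :
    ∃ a : ℂ, 1 < ‖a‖ ∧ ‖a‖ ≤ ‖b‖
      ∧ (∀ t : ℝ, log ‖(arcPoly c t : ℂ) - w‖ = (log (1 / c ^ 2) - log 2 - log ‖a‖)
        + (log ‖Complex.exp (t * Complex.I) - a‖
          + log ‖Complex.exp (t * Complex.I) - starRingEnd ℂ a‖))
      ∧ ∀ t : ℝ, ∀ z, z = a ∨ z = starRingEnd ℂ a →
        1 + cos t - c ^ 2 * (1 + ‖b‖) ≤ ‖Complex.exp (t * Complex.I) - z‖ := by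
  obtain ⟨a, ha, hy⟩ := exists_joukowski ((c : ℂ) ^ 2 * (1 + w) - 1)
  have ha0 : a ≠ 0 := norm_pos_iff.1 (by linarith)
  have hb0 : b ≠ 0 := norm_pos_iff.1 (by linarith)
  have hc2 : ‖(c : ℂ) ^ 2‖ = c ^ 2 := by simp
  have hc21 : c ^ 2 ≤ 1 := pow_le_one₀ hc.le hc1
  have hane : ‖a‖ ≠ 1 := by
    intro h
    have h1 : a⁻¹ = starRingEnd ℂ a := by
      rw [Complex.inv_def, Complex.normSq_eq_norm_sq, h]
      simp
    rw [h1, Complex.add_conj] at hy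
    have h2 := congrArg Complex.im hy
    have h3 : ((c : ℂ) ^ 2 * (1 + w) - 1).im = c ^ 2 * w.im := by
      rw [← Complex.ofReal_pow, Complex.sub_im, Complex.im_ofReal_mul]
      simp
    rw [h3] at h2
    have h4 : (((2 * a.re : ℝ) : ℂ) / 2).im = 0 := by
      rw [show ((2 * a.re : ℝ) : ℂ) / 2 = (a.re : ℂ) by push_cast; ring]
      simp
    rw [h4] at h2
    exact mul_ne_zero (by positivity) hw h2
  have ha1 : 1 < ‖a‖ := lt_of_le_of_ne ha (Ne.symm hane)
  have hab : ‖a‖ ≤ ‖b‖ := by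
    refine le_of_add_inv_le ha hb ?_
    have hB := joukowski_focal_sum hb0
    rw [← joukowski_focal_sum ha0, ← hy]
    rw [← hwb] at hB
    have e1 : (c : ℂ) ^ 2 * (1 + w) - 1 - 1 = (c : ℂ) ^ 2 * (w - 1) - ((2 * (1 - c ^ 2) : ℝ) : ℂ) := by
      push_cast; ring
    have e2 : (c : ℂ) ^ 2 * (1 + w) - 1 + 1 = (c : ℂ) ^ 2 * (w + 1) := by ring
    have h1 : ‖(c : ℂ) ^ 2 * (1 + w) - 1 - 1‖ ≤ c ^ 2 * ‖w - 1‖ + 2 * (1 - c ^ 2) := by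
      rw [e1]
      refine (norm_sub_le _ _).trans (le_of_eq ?_)
      rw [norm_mul, hc2, Complex.norm_real, Real.norm_eq_abs, abs_of_nonneg (by linarith)]
    have h2 : ‖(c : ℂ) ^ 2 * (1 + w) - 1 + 1‖ = c ^ 2 * ‖w + 1‖ := by rw [e2, norm_mul, hc2]
    have h3 : 2 ≤ ‖b‖ + ‖b‖⁻¹ := by
      rw [← hB]
      calc (2 : ℝ) = ‖(w + 1) - (w - 1)‖ := by ring_nf; simp
        _ ≤ ‖w + 1‖ + ‖w - 1‖ := norm_sub_le _ _
        _ = _ := add_comm _ _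
    nlinarith
  have hapos : 0 < ‖a‖ := by linarith
  have hconj : ‖starRingEnd ℂ a‖ = ‖a‖ := Complex.norm_conj a
  refine ⟨a, ha1, hab, fun t => ?_, fun t => ?_⟩
  · have n1 : ‖Complex.exp (t * Complex.I) - a‖ ≠ 0 :=
      norm_ne_zero_iff.2 (exp_mul_I_sub_ne_zero hane t)
    have n2 : ‖Complex.exp (t * Complex.I) - starRingEnd ℂ a‖ ≠ 0 :=
      norm_ne_zero_iff.2 (exp_mul_I_sub_ne_zero (by rwa [hconj]) t)
    have h := norm_mul_norm_conj ha0 hy t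
    have n3 : ‖(cos t : ℂ) - (c ^ 2 * (1 + w) - 1)‖ ≠ 0 := fun h0 => by
      rw [h0, mul_zero] at h
      exact mul_ne_zero n1 n2 h
    have e : (arcPoly c t : ℂ) - w
        = ((1 / c ^ 2 : ℝ) : ℂ) * ((cos t : ℂ) - (c ^ 2 * (1 + w) - 1)) := by
      have : (c : ℂ) ≠ 0 := by exact_mod_cast hc.ne'
      unfold arcPoly
      push_cast
      field_simp
      ring
    rw [← log_mul n1 n2, h, log_mul (mul_pos two_pos hapos).ne' n3, log_mul (by norm_num) hapos.ne', e,
      norm_mul, Complex.norm_real, Real.norm_eq_abs, abs_of_pos (by positivity : 0 < 1 / c ^ 2),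
      log_mul (by positivity) n3]
    ring
  · have hlow : 1 + cos t - c ^ 2 * (1 + ‖b‖) ≤ ‖(cos t : ℂ) - (c ^ 2 * (1 + w) - 1)‖ := by
      have hwn : ‖w‖ ≤ ‖b‖ := by
        rw [hwb, norm_div, Complex.norm_ofNat]
        have := norm_add_le b b⁻¹
        rw [norm_inv] at this
        have hi : ‖b‖⁻¹ ≤ 1 := inv_le_one_of_one_le₀ hb
        linarith
      have hre : ((cos t : ℂ) - (c ^ 2 * (1 + w) - 1)).re = 1 + cos t - c ^ 2 * (1 + w.re) := by
        rw [← Complex.ofReal_pow, Complex.sub_re, Complex.sub_re, Complex.re_ofReal_mul,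
          Complex.ofReal_re]
        simp
        ring
      refine le_trans ?_ (Complex.re_le_norm _)
      rw [hre]
      have := (Complex.re_le_norm w).trans hwn
      gcongr
    have gen : ∀ p q : ℝ, 0 ≤ p → q ≤ 1 + ‖a‖ →
        p * q = 2 * ‖a‖ * ‖(cos t : ℂ) - (c ^ 2 * (1 + w) - 1)‖ →
        1 + cos t - c ^ 2 * (1 + ‖b‖) ≤ p := by
      intro p q hp hq hpq
      refine hlow.trans ?_
      have h1 := mul_le_mul_of_nonneg_left hq hp
      rw [hpq] at h1
      have h2 : (1 + ‖a‖) * ‖(cos t : ℂ) - (c ^ 2 * (1 + w) - 1)‖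
          ≤ 2 * ‖a‖ * ‖(cos t : ℂ) - (c ^ 2 * (1 + w) - 1)‖ := by gcongr; linarith
      exact le_of_mul_le_mul_left (by linarith) (by linarith : 0 < 1 + ‖a‖)
    have hn : ∀ z : ℂ, ‖z‖ = ‖a‖ → ‖Complex.exp (t * Complex.I) - z‖ ≤ 1 + ‖a‖ := fun z hz => by
      have := norm_sub_le (Complex.exp (t * Complex.I)) z
      rwa [Complex.norm_exp_ofReal_mul_I, hz] at this
    have h := norm_mul_norm_conj ha0 hy t
    rintro z (rfl | rfl)
    · exact gen _ _ (norm_nonneg _) (hn _ hconj) h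
    · exact gen _ _ (norm_nonneg _) (hn _ rfl) (by rw [mul_comm, h])

lemma poisson_log_norm_sub_sub_le {r : ℝ} (hr : 0 < r) (hr1 : r < 1) {z : ℂ} (hz : 1 < ‖z‖)
    (t : ℝ) {R d : ℝ} (hR : ‖z‖ ≤ R) (hd : 0 < d) (hdz : d ≤ ‖Complex.exp (t * Complex.I) - z‖) :
    poisson r (fun s => log ‖Complex.exp (s * Complex.I) - z‖) t
      - log ‖Complex.exp (t * Complex.I) - z‖
      ≤ 1 / 2 * (log r + (1 - r) * (R ^ 2 - r) / (r * d ^ 2)) := by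
  rw [poisson_log_norm_sub hr hr1 hz]
  have h0 : 0 < ‖Complex.exp (t * Complex.I) - z‖ := hd.trans_le hdz
  have hid : ‖r * Complex.exp (t * Complex.I) - z‖ ^ 2
      = r * ‖Complex.exp (t * Complex.I) - z‖ ^ 2 + (1 - r) * (‖z‖ ^ 2 - r) := by
    simp only [← Complex.normSq_eq_norm_sq, Complex.normSq_apply, Complex.sub_re,
      Complex.sub_im, Complex.re_ofReal_mul, Complex.im_ofReal_mul,
      Complex.exp_ofReal_mul_I_re, Complex.exp_ofReal_mul_I_im]
    have := sin_sq_add_cos_sq t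
    linear_combination (r ^ 2 - r) * this
  have hpos : 0 < (1 - r) * (‖z‖ ^ 2 - r) := mul_pos (by linarith) (by nlinarith)
  have h1 : 0 < ‖r * Complex.exp (t * Complex.I) - z‖ := by
    refine (norm_nonneg _).lt_of_ne fun h => ?_
    rw [← h] at hid
    nlinarith [mul_pos hr (pow_pos h0 2)]
  have h2 : ‖r * Complex.exp (t * Complex.I) - z‖ ^ 2
      ≤ (r * ‖Complex.exp (t * Complex.I) - z‖ ^ 2)
        * (1 + (1 - r) * (R ^ 2 - r) / (r * d ^ 2)) := by
    rw [hid, mul_add, mul_one]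
    refine add_le_add le_rfl ?_
    rw [mul_div_assoc', le_div_iff₀ (by positivity), mul_comm (r * ‖_‖ ^ 2)]
    have hz2 : 0 ≤ ‖z‖ ^ 2 - r := by nlinarith
    have hR2 : ‖z‖ ^ 2 - r ≤ R ^ 2 - r := by gcongr
    have hR3 : 0 ≤ (1 - r) * (R ^ 2 - r) := mul_nonneg (by linarith) (hz2.trans hR2)
    gcongr
  have hX : 0 ≤ (1 - r) * (R ^ 2 - r) / (r * d ^ 2) := by
    have : ‖z‖ ^ 2 ≤ R ^ 2 := by gcongr
    have h3 : (1 - r) * (‖z‖ ^ 2 - r) ≤ (1 - r) * (R ^ 2 - r) := by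
      gcongr
    exact div_nonneg (hpos.le.trans h3) (by positivity)
  have h3 := log_le_log (by positivity) h2
  rw [log_mul (by positivity) (by positivity), log_mul hr.ne' (by positivity), log_pow, log_pow]
    at h3
  have h4 := log_le_sub_one_of_pos (by positivity :
    0 < 1 + (1 - r) * (R ^ 2 - r) / (r * d ^ 2))
  push_cast at h3
  linarith

/-- Estimates for one logarithmic factor of `T_m (arcPoly c) - i`. -/
lemma log_norm_arcPoly_sub_bounds {c : ℝ} (hc : 0 < c) (hc1 : c ≤ 1) {w b : ℂ} (hw : w.im ≠ 0)
    (hb : 1 ≤ ‖b‖) (hwb : w = (b + b⁻¹) / 2) {R : ℝ} (hR : ‖b‖ ≤ R) :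
    Continuous (fun t : ℝ => log ‖(arcPoly c t : ℂ) - w‖)
      ∧ mean (fun t : ℝ => log ‖(arcPoly c t : ℂ) - w‖) ≤ log (1 / c ^ 2) - log 2 + log R
      ∧ ∀ r, 0 < r → r < 1 → ∀ t d, 0 < d → d ≤ 1 + cos t - c ^ 2 * (1 + R) →
        poisson r (fun t : ℝ => log ‖(arcPoly c t : ℂ) - w‖) t - log ‖(arcPoly c t : ℂ) - w‖
          ≤ log r + (1 - r) * (R ^ 2 - r) / (r * d ^ 2) := by
  obtain ⟨a, ha1, hab, hlog, hlow⟩ := exists_log_norm_arcPoly_sub hc hc1 hw hb hwb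
  have haR := hab.trans hR
  have hconj : ‖starRingEnd ℂ a‖ = ‖a‖ := Complex.norm_conj a
  have c1 := continuous_log_norm_sub ha1.ne'
  have c2 := continuous_log_norm_sub (z := starRingEnd ℂ a) (by rw [hconj]; exact ha1.ne')
  have c3 : Continuous fun t : ℝ => log ‖Complex.exp (t * Complex.I) - a‖
      + log ‖Complex.exp (t * Complex.I) - starRingEnd ℂ a‖ := c1.add c2
  simp only [hlog]
  refine ⟨continuous_const.add c3, ?_, fun r hr hr1 t d hd hdt => ?_⟩
  · rw [mean_add continuous_const c3, mean_add c1 c2, mean_const, mean_log_norm_sub,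
      mean_log_norm_sub, hconj, posLog_eq_log (by rw [abs_norm]; exact ha1.le)]
    have := log_le_log (by linarith) haR
    linarith
  · rw [poisson_add hr hr1 continuous_const c3, poisson_add hr hr1 c1 c2,
      poisson_const hr hr1]
    have hd' : d ≤ 1 + cos t - c ^ 2 * (1 + ‖b‖) := hdt.trans (by gcongr)
    have h1 := poisson_log_norm_sub_sub_le hr hr1 ha1 t haR hd (hd'.trans (hlow t a (Or.inl rfl)))
    have h2 := poisson_log_norm_sub_sub_le hr hr1 (z := starRingEnd ℂ a) (by rwa [hconj]) t
      (R := R) (by rwa [hconj]) hd (hd'.trans (hlow t _ (Or.inr rfl)))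
    linarith

lemma green_arcPoly_approx {c : ℝ} (hc : 0 < c) (hc1 : c ≤ 1) {m : ℕ} (hm : 1 ≤ m) :
    mean (fun t => green (arcPoly c t))
        ≤ 1 / m * ((m - 1) * log 2) + (log (1 / c ^ 2) - log 2 + log (exp (log 3 / m))) + 2 / m
      ∧ ∀ r, 0 < r → r < 1 → ∀ t d, 0 < d → d ≤ 1 + cos t - c ^ 2 * (1 + exp (log 3 / m)) →
        poisson r (fun t => green (arcPoly c t)) t - green (arcPoly c t)
          ≤ log r + (1 - r) * (exp (log 3 / m) ^ 2 - r) / (r * d ^ 2) + 2 / m + 2 / m := by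
  obtain ⟨W, hW, hWb, hlog⟩ := exists_roots_T_sub_I hm
  have hm' : (0 : ℝ) < m := by exact_mod_cast hm
  have hB : ∀ w ∈ W, Continuous (fun t : ℝ => log ‖(arcPoly c t : ℂ) - w‖)
      ∧ mean (fun t : ℝ => log ‖(arcPoly c t : ℂ) - w‖)
        ≤ log (1 / c ^ 2) - log 2 + log (exp (log 3 / m))
      ∧ ∀ r, 0 < r → r < 1 → ∀ t d, 0 < d → d ≤ 1 + cos t - c ^ 2 * (1 + exp (log 3 / m)) →
        poisson r (fun t : ℝ => log ‖(arcPoly c t : ℂ) - w‖) t - log ‖(arcPoly c t : ℂ) - w‖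
          ≤ log r + (1 - r) * (exp (log 3 / m) ^ 2 - r) / (r * d ^ 2) := by
    intro w hw
    obtain ⟨him, b, hb, hbm, hwb⟩ := hWb w hw
    refine log_norm_arcPoly_sub_bounds hc hc1 him hb hwb ?_
    have hb0 : 0 < ‖b‖ := by linarith
    rw [← log_le_iff_le_exp hb0, le_div_iff₀ hm', mul_comm, ← log_pow]
    exact log_le_log (by positivity) hbm
  have hcont := continuous_multiset_map_sum W (F := fun w t => log ‖(arcPoly c t : ℂ) - w‖)
    fun w hw => (hB w hw).1
  set S : ℝ → ℝ := fun t => (W.map fun w => log ‖(arcPoly c t : ℂ) - w‖).sum with hS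
  have hv : Continuous fun t => green (arcPoly c t) :=
    continuous_green.comp (continuous_arcPoly c)
  have happ : ∀ t, |(1 / m * ((m - 1) * log 2) + 1 / m * S t : ℝ) - green (arcPoly c t)| ≤ 2 / m := by
    intro t
    have h := abs_log_norm_T_sub_I_sub_le hm (arcPoly c t)
    rwa [hlog, mul_add] at h
  have hvm : Continuous fun t => (1 / m * ((m - 1) * log 2) + 1 / m * S t : ℝ) := by fun_prop
  have hcancel : ∀ x : ℝ, 1 / m * (W.card • x) = x := fun x => by
    rw [hW, nsmul_eq_mul]
    field_simp
  refine ⟨?_, fun r hr hr1 t d hd hdt => ?_⟩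
  · have h1 : mean (fun t => green (arcPoly c t))
        ≤ mean fun t => ((1 / m * ((m - 1) * log 2) + 1 / m * S t) + 2 / m : ℝ) :=
      mean_mono hv (by fun_prop) fun t => by linarith [(abs_le.1 (happ t)).1]
    rw [mean_add hvm continuous_const, mean_add continuous_const (by fun_prop), mean_const,
      mean_const, mean_const_mul, hS, mean_multiset_map_sum W fun w hw => (hB w hw).1] at h1
    have h2 := Multiset.sum_le_card_nsmul (W.map fun w => mean fun t : ℝ => log ‖(arcPoly c t : ℂ) - w‖)
      (log (1 / c ^ 2) - log 2 + log (exp (log 3 / m))) fun x hx => by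
        obtain ⟨w, hw, rfl⟩ := Multiset.mem_map.1 hx
        exact (hB w hw).2.1
    rw [Multiset.card_map] at h2
    have h3 := mul_le_mul_of_nonneg_left h2 (by positivity : (0 : ℝ) ≤ 1 / m)
    rw [hcancel] at h3
    linarith
  · have h1 : poisson r (fun t => green (arcPoly c t)) t
        ≤ poisson r (fun t => ((1 / m * ((m - 1) * log 2) + 1 / m * S t) + 2 / m : ℝ)) t :=
      poisson_mono hr hr1 hv (by fun_prop) (fun t => by linarith [(abs_le.1 (happ t)).1]) t
    rw [poisson_add hr hr1 hvm continuous_const, poisson_add hr hr1 continuous_const (by fun_prop),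
      poisson_const hr hr1, poisson_const hr hr1, poisson_const_mul, hS,
      poisson_multiset_map_sum hr hr1 W fun w hw => (hB w hw).1] at h1
    have h2 := Multiset.sum_le_card_nsmul (W.map fun w =>
        poisson r (fun t : ℝ => log ‖(arcPoly c t : ℂ) - w‖) t - log ‖(arcPoly c t : ℂ) - w‖)
      (log r + (1 - r) * (exp (log 3 / m) ^ 2 - r) / (r * d ^ 2)) fun x hx => by
        obtain ⟨w, hw, rfl⟩ := Multiset.mem_map.1 hx
        exact (hB w hw).2.2 r hr hr1 t d hd hdt
    rw [Multiset.card_map, Multiset.sum_map_sub] at h2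
    have h3 := mul_le_mul_of_nonneg_left h2 (by positivity : (0 : ℝ) ≤ 1 / m)
    rw [hcancel, mul_sub] at h3
    linarith [(abs_le.1 (happ t)).2]

lemma tendsto_exp_log_three_div :
    Tendsto (fun m : ℕ => exp (log 3 / m)) atTop (𝓝 1) := by
  rw [← exp_zero]
  exact (continuous_exp.tendsto 0).comp (tendsto_const_div_atTop_nhds_zero_nat _)

lemma mean_green_arcPoly_le {c : ℝ} (hc : 0 < c) (hc1 : c ≤ 1) :
    mean (fun t => green (arcPoly c t)) ≤ log (1 / c ^ 2) := by
  have h : Tendsto (fun m : ℕ => (1 / m * ((m - 1) * log 2)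
      + (log (1 / c ^ 2) - log 2 + log (exp (log 3 / m))) + 2 / m : ℝ)) atTop
      (𝓝 (log 2 + (log (1 / c ^ 2) - log 2 + log 1) + 0)) :=
    ((tendsto_one_div_mul_sub_one_mul (log 2)).add (tendsto_const_nhds.add
      (tendsto_exp_log_three_div.log one_ne_zero))).add (tendsto_const_div_atTop_nhds_zero_nat 2)
  have e : log 2 + (log (1 / c ^ 2) - log 2 + log 1) + 0 = log (1 / c ^ 2) := by
    rw [log_one]; ring
  rw [e] at h
  exact ge_of_tendsto h (eventually_atTop.2 ⟨1, fun m hm => (green_arcPoly_approx hc hc1 hm).1⟩)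

lemma poisson_green_arcPoly_sub_le {c : ℝ} (hc : 0 < c) (hc1 : c ≤ 1) {r : ℝ} (hr : 0 < r)
    (hr1 : r < 1) {t d : ℝ} (hd : 0 < d) (hdt : d < 1 + cos t - 2 * c ^ 2) :
    poisson r (fun t => green (arcPoly c t)) t - green (arcPoly c t)
      ≤ log r + (1 - r) ^ 2 / (r * d ^ 2) := by
  have hE := tendsto_exp_log_three_div
  have h2 : Tendsto (fun m : ℕ => (2 / m : ℝ)) atTop (𝓝 0) :=
    tendsto_const_div_atTop_nhds_zero_nat 2
  have h : Tendsto (fun m : ℕ => (log r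
      + (1 - r) * (exp (log 3 / m) ^ 2 - r) / (r * d ^ 2) + 2 / m + 2 / m : ℝ)) atTop
      (𝓝 (log r + (1 - r) * (1 ^ 2 - r) / (r * d ^ 2) + 0 + 0)) :=
    ((tendsto_const_nhds.add ((((hE.pow 2).sub_const r).const_mul (1 - r)).div_const _)).add
      h2).add h2
  have e : log r + (1 - r) * (1 ^ 2 - r) / (r * d ^ 2) + 0 + 0
      = log r + (1 - r) ^ 2 / (r * d ^ 2) := by ring
  rw [e] at h
  have hev : ∀ᶠ m : ℕ in atTop, d < 1 + cos t - c ^ 2 * (1 + exp (log 3 / m)) := by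
    have : Tendsto (fun m : ℕ => 1 + cos t - c ^ 2 * (1 + exp (log 3 / m))) atTop
        (𝓝 (1 + cos t - c ^ 2 * (1 + 1))) :=
      tendsto_const_nhds.sub ((hE.const_add 1).const_mul _)
    exact this.eventually_const_lt (by linarith)
  refine ge_of_tendsto h ?_
  filter_upwards [hev, eventually_ge_atTop 1] with m h3 h1
  exact (green_arcPoly_approx hc hc1 h1).2 r hr hr1 t d hd h3.le

lemma arcPoly_eq_trigPoly (c t : ℝ) :
    arcPoly c t = trigPoly 1 (fun k => if k = 0 then 2 * (1 / c ^ 2 - 1) else 1 / c ^ 2) 0 t := by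
  simp [arcPoly, trigPoly]
  ring

lemma isLogPot_green_arcPoly {c : ℝ} (hc : 0 < c) :
    IsLogPot 1 (log (1 / c ^ 2)) fun t => green (arcPoly c t) := by
  have hA : √((1 / c ^ 2) ^ 2 + (0 : ℝ) ^ 2) = 1 / c ^ 2 := by
    rw [zero_pow two_ne_zero, add_zero, sqrt_sq (by positivity)]
  have h := isLogPot_green_trigPoly le_rfl
    (a := fun k => if k = 0 then 2 * (1 / c ^ 2 - 1) else 1 / c ^ 2) (b := 0)
  simp only [← arcPoly_eq_trigPoly, one_ne_zero, if_false, Pi.zero_apply, hA, Nat.cast_one] at h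
  exact h (by positivity)

end Babenko

namespace Babenko

open Real Filter Topology

section Rearrangement

variable {ι : Type*} [AddCommGroup ι]

variable [Fintype ι] in
/-- The energy of `w` with respect to the kernel `K (c (i - j))`. -/
def energy (K : ℝ → ℝ) (c w : ι → ℝ) : ℝ := ∑ i, ∑ j, K (c (i - j)) * (w i * w j)

/-- The two-point rearrangement of `w` with respect to the reflection `i ↦ a - i`. -/
noncomputable def polarization (c w : ι → ℝ) (a : ι) (i : ι) : ι :=
  open Classical in if (c i - c (a - i)) * (w i - w (a - i)) < 0 then a - i else i

lemma polarization_sub (c w : ι → ℝ) (a i : ι) :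
    polarization c w a (a - i) = a - polarization c w a i := by
  unfold polarization
  rw [sub_sub_cancel]
  have : (c (a - i) - c i) * (w (a - i) - w i) = (c i - c (a - i)) * (w i - w (a - i)) := by ring
  rw [this]
  split_ifs <;> simp

lemma polarization_involutive (c w : ι → ℝ) (a : ι) :
    Function.Involutive (polarization c w a) := by
  intro i
  by_cases h : (c i - c (a - i)) * (w i - w (a - i)) < 0
  · have : polarization c w a i = a - i := if_pos h
    rw [this, polarization_sub, this, sub_sub_cancel]
  · have : polarization c w a i = i := if_neg h
    rw [this, this]

lemma polarization_diff (c w : ι → ℝ) (a i : ι) :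
    (c i - c (a - i)) * (w (polarization c w a i) - w (polarization c w a (a - i)))
      = |(c i - c (a - i)) * (w i - w (a - i))| := by
  rw [polarization_sub]
  by_cases h : (c i - c (a - i)) * (w i - w (a - i)) < 0
  · have : polarization c w a i = a - i := if_pos h
    rw [this, sub_sub_cancel, abs_of_neg h]
    ring
  · have : polarization c w a i = i := if_neg h
    rw [this, abs_of_nonneg (not_lt.1 h)]

lemma polarization_add (c w : ι → ℝ) (a i : ι) :
    w (polarization c w a i) + w (polarization c w a (a - i)) = w i + w (a - i) := by
  rw [polarization_sub]
  unfold polarization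
  split_ifs
  · rw [sub_sub_cancel, add_comm]
  · rfl

lemma polarization_diff_eq_or (c w : ι → ℝ) (a i : ι) :
    w (polarization c w a i) - w (polarization c w a (a - i)) = w i - w (a - i)
      ∨ w (polarization c w a i) - w (polarization c w a (a - i)) = -(w i - w (a - i)) := by
  rw [polarization_sub]
  unfold polarization
  split_ifs
  · right
    rw [sub_sub_cancel]
    ring
  · left; rfl

variable [Fintype ι]

lemma sum_reflect (a : ι) (g : ι → ℝ) : ∑ i, g (a - i) = ∑ i, g i :=
  Equiv.sum_comp (Equiv.subLeft a) g

lemma four_mul_sum_mul (c w : ι → ℝ) (a : ι) :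
    4 * ∑ i, c i * w i
      = ∑ i, ((c i + c (a - i)) * (w i + w (a - i)) + (c i - c (a - i)) * (w i - w (a - i))) := by
  have h := sum_reflect a fun i => c i * w i
  have e : ∀ i, (c i + c (a - i)) * (w i + w (a - i)) + (c i - c (a - i)) * (w i - w (a - i))
      = 2 * (c i * w i) + 2 * (c (a - i) * w (a - i)) := fun i => by ring
  simp only [e, Finset.sum_add_distrib, ← Finset.mul_sum, h]
  ring

lemma sum_lt_sum_polarization (c w : ι → ℝ) (a : ι) {p : ι}
    (hp : (c p - c (a - p)) * (w p - w (a - p)) < 0) :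
    ∑ i, c i * w i < ∑ i, c i * w (polarization c w a i) := by
  have h1 := four_mul_sum_mul c w a
  have h2 := four_mul_sum_mul c (w ∘ polarization c w a) a
  simp only [Function.comp_apply, polarization_add, polarization_diff] at h2
  have : ∑ i, ((c i + c (a - i)) * (w i + w (a - i)) + (c i - c (a - i)) * (w i - w (a - i)))
      < ∑ i, ((c i + c (a - i)) * (w i + w (a - i)) + |(c i - c (a - i)) * (w i - w (a - i))|) :=
    Finset.sum_lt_sum (fun i _ => add_le_add le_rfl (le_abs_self _))
      ⟨p, Finset.mem_univ _, add_lt_add_right (hp.trans_le (abs_nonneg _)) _⟩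
  linarith

lemma eight_mul_energy {K : ℝ → ℝ} {c : ι → ℝ} (hsymm : ∀ i, c (-i) = c i) (w : ι → ℝ) (a : ι) :
    8 * energy K c w = ∑ i, ∑ j,
      ((K (c (i - j)) + K (c (i - (a - j)))) * ((w i + w (a - i)) * (w j + w (a - j)))
        + (K (c (i - j)) - K (c (i - (a - j)))) * ((w i - w (a - i)) * (w j - w (a - j)))) := by
  have r1 : ∀ i j, c (a - i - (a - j)) = c (i - j) := fun i j => by
    rw [← hsymm]; congr 1; abel
  have r2 : ∀ i j, c (a - i - j) = c (i - (a - j)) := fun i j => by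
    rw [← hsymm]; congr 1; abel
  have e1 : energy K c w = ∑ i, ∑ j, K (c (i - j)) * (w (a - i) * w (a - j)) := by
    rw [energy, ← sum_reflect a]
    refine Finset.sum_congr rfl fun i _ => ?_
    rw [← sum_reflect a]
    simp only [r1]
  have e2 : energy K c w = ∑ i, ∑ j, K (c (i - (a - j))) * (w i * w (a - j)) := by
    rw [energy]
    refine Finset.sum_congr rfl fun i _ => ?_
    rw [← sum_reflect a]
  have e3 : energy K c w = ∑ i, ∑ j, K (c (i - (a - j))) * (w (a - i) * w j) := by
    rw [energy, ← sum_reflect a]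
    simp only [r2]
  have e : ∀ i j,
      (K (c (i - j)) + K (c (i - (a - j)))) * ((w i + w (a - i)) * (w j + w (a - j)))
        + (K (c (i - j)) - K (c (i - (a - j)))) * ((w i - w (a - i)) * (w j - w (a - j)))
      = 2 * (K (c (i - j)) * (w i * w j)) + 2 * (K (c (i - j)) * (w (a - i) * w (a - j)))
        + 2 * (K (c (i - (a - j))) * (w i * w (a - j)))
        + 2 * (K (c (i - (a - j))) * (w (a - i) * w j)) := fun i j => by ring
  simp only [e, Finset.sum_add_distrib, ← Finset.mul_sum]
  rw [← e1, ← e2, ← e3, ← energy]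
  ring

variable {K : ℝ → ℝ} {c s : ι → ℝ}

lemma energy_le_energy_polarization (hK : MonotoneOn K (Set.Icc (-1) 1))
    (hc : ∀ i j, c (i - j) = c i * c j + s i * s j)
    (hs : ∀ i j, s (i - j) = s i * c j - c i * s j) (h1 : ∀ i, c i ^ 2 + s i ^ 2 = 1)
    (w : ι → ℝ) (a : ι) :
    energy K c w ≤ energy K c (w ∘ polarization c w a) := by
  have hmem : ∀ i, c i ∈ Set.Icc (-1 : ℝ) 1 := fun i =>
    ⟨by nlinarith [h1 i, sq_nonneg (s i)], by nlinarith [h1 i, sq_nonneg (s i)]⟩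
  have h00 : c 0 = 1 := by
    have := hc 0 0
    rw [sub_zero] at this
    nlinarith [h1 0]
  have hs0 : s 0 = 0 := by
    have := h1 0
    rw [h00] at this
    nlinarith
  have hsymm : ∀ i, c (-i) = c i := fun i => by
    rw [← zero_sub, hc, h00, hs0]
    ring
  rcases (hmem a).2.lt_or_eq with hca | heq
  swap
  · have hsa : s a = 0 := by
      have := h1 a
      rw [heq] at this
      nlinarith
    refine le_of_eq (congrArg _ (funext fun i => ?_))
    have : ¬ (c i - c (a - i)) * (w i - w (a - i)) < 0 := by
      rw [hc a i, heq, hsa]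
      simp
    rw [Function.comp_apply, polarization, if_neg this]
  have h8 := eight_mul_energy (K := K) hsymm w a
  have h8' := eight_mul_energy (K := K) hsymm (w ∘ polarization c w a) a
  simp only [Function.comp_apply, polarization_add] at h8'
  suffices h : ∀ i j, (K (c (i - j)) - K (c (i - (a - j)))) * ((w i - w (a - i)) * (w j - w (a - j)))
      ≤ (K (c (i - j)) - K (c (i - (a - j))))
        * ((w (polarization c w a i) - w (polarization c w a (a - i)))
          * (w (polarization c w a j) - w (polarization c w a (a - j)))) by
    have := Finset.sum_le_sum fun i (_ : i ∈ Finset.univ) =>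
      Finset.sum_le_sum fun j (_ : j ∈ Finset.univ) =>
        add_le_add (le_refl ((K (c (i - j)) + K (c (i - (a - j))))
          * ((w i + w (a - i)) * (w j + w (a - j))))) (h i j)
    linarith
  intro i j
  have hi := polarization_diff c w a i
  have hj := polarization_diff c w a j
  have di := polarization_diff_eq_or c w a i
  have dj := polarization_diff_eq_or c w a j
  set Di := w (polarization c w a i) - w (polarization c w a (a - i))
  set Dj := w (polarization c w a j) - w (polarization c w a (a - j))
  have hDi : 0 ≤ (c i - c (a - i)) * Di := hi ▸ abs_nonneg _
  have hDj : 0 ≤ (c j - c (a - j)) * Dj := hj ▸ abs_nonneg _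
  have hid : (1 - c a) * (c (i - j) - c (i - (a - j))) = (c i - c (a - i)) * (c j - c (a - j)) := by
    rw [hc i j, hc i (a - j), hs a j, hc a i, hc a j]
    linear_combination (-s i * s j) * h1 a
  have hpos : 0 ≤ (K (c (i - j)) - K (c (i - (a - j)))) * (Di * Dj) := by
    have hD := mul_nonneg hDi hDj
    have hprod : (c i - c (a - i)) * Di * ((c j - c (a - j)) * Dj)
        = (1 - c a) * (c (i - j) - c (i - (a - j))) * (Di * Dj) := by rw [hid]; ring
    rw [hprod] at hD
    have hD' : 0 ≤ (c (i - j) - c (i - (a - j))) * (Di * Dj) := by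
      rw [mul_assoc] at hD
      exact nonneg_of_mul_nonneg_right hD (by linarith)
    rcases lt_trichotomy (c (i - j)) (c (i - (a - j))) with h | h | h
    · exact mul_nonneg_of_nonpos_of_nonpos (sub_nonpos.2 (hK (hmem _) (hmem _) h.le))
        (nonpos_of_mul_nonneg_right hD' (sub_neg.2 h))
    · rw [h]; simp
    · exact mul_nonneg (sub_nonneg.2 (hK (hmem _) (hmem _) h.le))
        (nonneg_of_mul_nonneg_right hD' (sub_pos.2 h))
  rcases di with di | di <;> rcases dj with dj | dj
  · rw [di, dj]
  · have : (w i - w (a - i)) * (w j - w (a - j)) = -(Di * Dj) := by rw [di, dj]; ring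
    rw [this]
    linarith
  · have : (w i - w (a - i)) * (w j - w (a - j)) = -(Di * Dj) := by rw [di, dj]; ring
    rw [this]
    linarith
  · have : (w i - w (a - i)) * (w j - w (a - j)) = Di * Dj := by rw [di, dj]; ring
    rw [this]

/-- **Rearrangement inequality on a finite cyclic group**: some permutation of `w` which is ordered
along the cosine `c` has at least the energy of `w`. -/
theorem exists_perm_energy_le (hK : MonotoneOn K (Set.Icc (-1) 1))
    (hc : ∀ i j, c (i - j) = c i * c j + s i * s j)
    (hs : ∀ i j, s (i - j) = s i * c j - c i * s j) (h1 : ∀ i, c i ^ 2 + s i ^ 2 = 1)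
    (w : ι → ℝ) :
    ∃ σ : Equiv.Perm ι, energy K c w ≤ energy K c (w ∘ σ)
      ∧ ∀ p q, c q < c p → w (σ q) ≤ w (σ p) := by
  classical
  obtain ⟨σ, hσ⟩ := Finite.exists_max fun σ : Equiv.Perm ι =>
    toLex (energy K c (w ∘ σ), ∑ i, c i * w (σ i))
  refine ⟨σ, ?_, fun p q hpq => ?_⟩
  · have h := hσ 1
    rw [Prod.Lex.toLex_le_toLex] at h
    rcases h with h | h
    · exact h.le
    · exact h.1.le
  · by_contra! hlt
    set a := p + q
    set τ := (polarization_involutive c (w ∘ σ) a).toPerm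
    have h := hσ (τ.trans σ)
    rw [Prod.Lex.toLex_le_toLex] at h
    have hE := energy_le_energy_polarization hK hc hs h1 (w ∘ σ) a
    have hS := sum_lt_sum_polarization c (w ∘ σ) a (p := p) (by
      rw [show a - p = q by simp [a]]
      exact mul_neg_of_pos_of_neg (sub_pos.2 hpq) (sub_neg.2 hlt))
    rcases h with h | h
    · exact absurd hE (not_le.2 h)
    · exact absurd hS (not_lt.2 h.2)

end Rearrangement
end Babenko

namespace Babenko

open Real Filter Topology

section Dirichlet

variable {ι : Type*} [Fintype ι]

/-- Expansion of the Dirichlet form of a symmetric kernel. -/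
lemma dirichlet_expand {k : ι → ι → ℝ} (hk : ∀ i j, k i j = k j i) (x y : ι → ℝ) :
    ∑ i, ∑ j, k i j * ((x i - x j) * (y i - y j))
      = 2 * ∑ i, x i * ∑ j, k i j * (y i - y j) := by
  have e1 : ∑ i, ∑ j, k i j * ((x i - x j) * (y i - y j))
      = ∑ i, ∑ j, x i * (k i j * (y i - y j)) - ∑ i, ∑ j, x j * (k i j * (y i - y j)) := by
    simp only [← Finset.sum_sub_distrib]
    refine Finset.sum_congr rfl fun i _ => Finset.sum_congr rfl fun j _ => by ring
  have e2 : ∑ i, ∑ j, x j * (k i j * (y i - y j)) = -∑ i, ∑ j, x i * (k i j * (y i - y j)) := by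
    rw [Finset.sum_comm, ← Finset.sum_neg_distrib]
    refine Finset.sum_congr rfl fun i _ => ?_
    rw [← Finset.sum_neg_distrib]
    refine Finset.sum_congr rfl fun j _ => ?_
    rw [hk]
    ring
  rw [e1, e2]
  simp only [← Finset.mul_sum]
  ring

lemma dirichlet_cauchy_schwarz {k : ι → ι → ℝ} (hk : ∀ i j, k i j = k j i)
    (hk0 : ∀ i j, 0 ≤ k i j) (x y : ι → ℝ) :
    (∑ i, x i * ∑ j, k i j * (y i - y j)) ^ 2
      ≤ (∑ i, x i * ∑ j, k i j * (x i - x j)) * ∑ i, y i * ∑ j, k i j * (y i - y j) := by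
  have h := Finset.sum_sq_le_sum_mul_sum_of_sq_le_mul (Finset.univ : Finset (ι × ι))
    (r := fun p => k p.1 p.2 * ((x p.1 - x p.2) * (y p.1 - y p.2)))
    (f := fun p => k p.1 p.2 * ((x p.1 - x p.2) * (x p.1 - x p.2)))
    (g := fun p => k p.1 p.2 * ((y p.1 - y p.2) * (y p.1 - y p.2)))
    (fun p _ => mul_nonneg (hk0 _ _) (mul_self_nonneg _))
    (fun p _ => mul_nonneg (hk0 _ _) (mul_self_nonneg _)) (fun p _ => le_of_eq (by ring))
  simp only [Fintype.sum_prod_type, dirichlet_expand hk] at h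
  nlinarith

/-- The comparison inequality: `w` is a rearrangement of `v` with smaller Dirichlet form,
`y` is a torsion function on the support of `w`. -/
lemma dirichlet_comparison {k : ι → ι → ℝ} (hk : ∀ i j, k i j = k j i)
    (hk0 : ∀ i j, 0 ≤ k i j) {κ : ℝ} (hκ : ∀ i, ∑ j, k i j = κ) {v y : ι → ℝ}
    (σ : Equiv.Perm ι) (hv0 : ∀ i, 0 ≤ v i) (hy0 : ∀ i, 0 ≤ y i) {B B₁ B₀ : ℝ} (hB : 0 ≤ B)
    (henergy : ∑ i, ∑ j, k i j * (v i * v j) ≤ ∑ i, ∑ j, k i j * (v (σ i) * v (σ j)))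
    (h₁ : ∀ i, ∑ j, k i j * (v i - v j) ≤ B₁) (h₀ : ∀ i, ∑ j, k i j * (y i - y j) ≤ B₀)
    (h : ∀ i, 0 < v (σ i) → B ≤ ∑ j, k i j * (y i - y j)) :
    (B * ∑ i, v i) ^ 2 ≤ (B₁ * ∑ i, v i) * (B₀ * ∑ i, y i) := by
  have hform : ∀ x : ι → ℝ, ∑ i, x i * ∑ j, k i j * (x i - x j)
      = κ * ∑ i, x i ^ 2 - ∑ i, ∑ j, k i j * (x i * x j) := by
    intro x
    rw [Finset.mul_sum, ← Finset.sum_sub_distrib]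
    refine Finset.sum_congr rfl fun i _ => ?_
    rw [← hκ i, Finset.sum_mul, ← Finset.sum_sub_distrib, Finset.mul_sum]
    exact Finset.sum_congr rfl fun j _ => by ring
  have hsq : ∑ i, v (σ i) ^ 2 = ∑ i, v i ^ 2 := Equiv.sum_comp σ fun i => v i ^ 2
  have hsum : ∑ i, v (σ i) = ∑ i, v i := Equiv.sum_comp σ v
  have q1 : ∑ i, v (σ i) * ∑ j, k i j * (v (σ i) - v (σ j)) ≤ B₁ * ∑ i, v i := by
    refine le_trans ?_ (?_ : ∑ i, v i * ∑ j, k i j * (v i - v j) ≤ _)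
    · rw [hform v, hform fun i => v (σ i), hsq]
      linarith
    · rw [mul_comm, Finset.sum_mul]
      exact Finset.sum_le_sum fun i _ => mul_le_mul_of_nonneg_left (h₁ i) (hv0 i)
  have q0 : ∑ i, y i * ∑ j, k i j * (y i - y j) ≤ B₀ * ∑ i, y i := by
    rw [mul_comm, Finset.sum_mul]
    exact Finset.sum_le_sum fun i _ => mul_le_mul_of_nonneg_left (h₀ i) (hy0 i)
  have q : B * ∑ i, v i ≤ ∑ i, v (σ i) * ∑ j, k i j * (y i - y j) := by
    rw [← hsum, mul_comm, Finset.sum_mul]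
    refine Finset.sum_le_sum fun i _ => ?_
    rcases (hv0 (σ i)).eq_or_lt with h0 | h0
    · rw [← h0]; simp
    · exact mul_le_mul_of_nonneg_left (h i h0) h0.le
  have hn : ∀ x : ι → ℝ, 0 ≤ ∑ i, x i * ∑ j, k i j * (x i - x j) := fun x => by
    have : 0 ≤ ∑ i, ∑ j, k i j * ((x i - x j) * (x i - x j)) :=
      Finset.sum_nonneg fun i _ => Finset.sum_nonneg fun j _ =>
        mul_nonneg (hk0 i j) (mul_self_nonneg _)
    rw [dirichlet_expand hk] at this
    linarith
  have hcs := dirichlet_cauchy_schwarz hk hk0 (fun i => v (σ i)) y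
  calc (B * ∑ i, v i) ^ 2 ≤ (∑ i, v (σ i) * ∑ j, k i j * (y i - y j)) ^ 2 := by
        have : 0 ≤ B * ∑ i, v i := mul_nonneg hB (Finset.sum_nonneg fun i _ => hv0 i)
        gcongr
    _ ≤ _ := hcs
    _ ≤ _ := mul_le_mul q1 q0 (hn y) ((hn fun i => v (σ i)).trans q1)

end Dirichlet

section Grid

/-- The angle of a point of the regular polygon. -/
noncomputable def angle {N : ℕ} (i : ZMod N) : ℝ := 2 * π * i.val / N

lemma exp_angle_sub {N : ℕ} [NeZero N] (i j : ZMod N) :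
    Complex.exp (angle (i - j) * Complex.I) = Complex.exp ((angle i - angle j : ℝ) * Complex.I) := by
  have h : ∀ i : ZMod N, (ZMod.toCircle i : ℂ) = Complex.exp (angle i * Complex.I) := fun i => by
    rw [ZMod.toCircle_apply, angle]
    congr 1
    push_cast
    ring
  rw [← h, AddChar.map_sub_eq_div, Circle.coe_div, h, h, ← Complex.exp_sub]
  congr 1
  push_cast
  ring

lemma cos_angle_sub {N : ℕ} [NeZero N] (i j : ZMod N) :
    cos (angle (i - j)) = cos (angle i - angle j) := by
  have h := congrArg Complex.re (exp_angle_sub i j)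
  rwa [Complex.exp_ofReal_mul_I_re, Complex.exp_ofReal_mul_I_re] at h

lemma sin_angle_sub {N : ℕ} [NeZero N] (i j : ZMod N) :
    sin (angle (i - j)) = sin (angle i - angle j) := by
  have h := congrArg Complex.im (exp_angle_sub i j)
  rwa [Complex.exp_ofReal_mul_I_im, Complex.exp_ofReal_mul_I_im] at h

lemma angle_mem {N : ℕ} [NeZero N] (i : ZMod N) : angle i ∈ Set.Icc (0 : ℝ) (2 * π) := by
  have hN : (0 : ℝ) < N := by exact_mod_cast Nat.pos_of_ne_zero (NeZero.ne N)
  have h : (i.val : ℝ) ≤ N := by exact_mod_cast (ZMod.val_lt i).le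
  unfold angle
  refine ⟨by positivity, ?_⟩
  rw [div_le_iff₀ hN]
  gcongr

/-- A rearrangement of a function on the polygon, supported where the cosine is large, which does
not decrease the Poisson energy. -/
lemma exists_perm_supported {N : ℕ} [NeZero N] {K : ℝ → ℝ} (hK : MonotoneOn K (Set.Icc (-1) 1))
    {v : ZMod N → ℝ} {x₀ : ℝ}
    (hcard : (Finset.univ.filter fun i => 0 < v i).card
      ≤ (Finset.univ.filter fun i : ZMod N => x₀ ≤ cos (angle i)).card) :
    ∃ σ : Equiv.Perm (ZMod N),
      ∑ i, ∑ j, K (cos (angle i - angle j)) * (v i * v j)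
        ≤ ∑ i, ∑ j, K (cos (angle i - angle j)) * (v (σ i) * v (σ j))
      ∧ ∀ i, 0 < v (σ i) → x₀ ≤ cos (angle i) := by
  obtain ⟨σ, hE, hσ⟩ := exists_perm_energy_le hK (c := fun i : ZMod N => cos (angle i))
    (s := fun i => sin (angle i)) (fun i j => by rw [cos_angle_sub, cos_sub])
    (fun i j => by rw [sin_angle_sub, sin_sub]) (fun i => cos_sq_add_sin_sq _) v
  refine ⟨σ, ?_, fun q hq => ?_⟩
  · simpa only [energy, cos_angle_sub, Function.comp_apply] using hE
  · by_contra! hlt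
    have hsub : insert q (Finset.univ.filter fun i : ZMod N => x₀ ≤ cos (angle i))
        ⊆ Finset.univ.filter fun i => 0 < v (σ i) := by
      intro p hp
      rw [Finset.mem_filter_univ]
      rcases Finset.mem_insert.1 hp with rfl | hp
      · exact hq
      · rw [Finset.mem_filter_univ] at hp
        exact hq.trans_le (hσ p q (hlt.trans_le hp))
    have h1 := Finset.card_le_card hsub
    rw [Finset.card_insert_of_notMem (by simpa using hlt)] at h1
    have h2 : (Finset.univ.filter fun i => 0 < v (σ i)).card
        = (Finset.univ.filter fun i => 0 < v i).card :=
      Finset.card_equiv σ (by simp)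
    omega

lemma sum_zmod_angle (m : ℕ) (g : ℝ → ℝ) :
    ∑ i : ZMod (m + 1), g (angle i)
      = ∑ j ∈ Finset.range (m + 1), g (2 * π * j / (m + 1 : ℕ)) :=
  Fin.sum_univ_eq_sum_range (fun j => g (2 * π * j / (m + 1 : ℕ))) (m + 1)

/-- Riemann sums of a continuous function of two variables converge uniformly. -/
lemma eventually_abs_riemann_sum_sub_mean_le {G : ℝ × ℝ → ℝ} (hG : Continuous G) {ε : ℝ}
    (hε : 0 < ε) :
    ∀ᶠ m : ℕ in atTop, ∀ t ∈ Set.Icc (0 : ℝ) (2 * π),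
      |(1 / (m + 1 : ℕ) : ℝ) * ∑ i : ZMod (m + 1), G (t, angle i) - mean fun s => G (t, s)| ≤ ε := by
  have huc := (isCompact_Icc.prod isCompact_Icc :
    IsCompact (Set.Icc (0 : ℝ) (2 * π) ×ˢ Set.Icc (0 : ℝ) (2 * π))).uniformContinuousOn_of_continuous
    hG.continuousOn
  rw [Metric.uniformContinuousOn_iff] at huc
  obtain ⟨δ, hδ, huc⟩ := huc ε hε
  have hlim : Tendsto (fun m : ℕ => 2 * π / ((m + 1 : ℕ) : ℝ)) atTop (𝓝 0) :=
    (tendsto_add_atTop_iff_nat (f := fun m : ℕ => 2 * π / (m : ℝ)) 1).2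
      (tendsto_const_div_atTop_nhds_zero_nat _)
  filter_upwards [hlim.eventually_lt_const hδ] with m hm t ht
  set N : ℝ := ((m + 1 : ℕ) : ℝ) with hN
  have hNpos : 0 < N := by rw [hN]; positivity
  have hpi := two_pi_pos
  have hcont : Continuous fun s => G (t, s) := by fun_prop
  set p : ℕ → ℝ := fun j => 2 * π * j / N with hp
  have hstep : ∀ j : ℕ, p (j + 1) - p j = 2 * π / N := fun j => by
    simp only [hp]; push_cast; ring
  have hpmem : ∀ j ≤ m + 1, p j ∈ Set.Icc (0 : ℝ) (2 * π) := fun j hj => by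
    refine ⟨by simp only [hp]; positivity, ?_⟩
    simp only [hp]
    rw [div_le_iff₀ hNpos]
    have : (j : ℝ) ≤ N := by rw [hN]; exact_mod_cast hj
    gcongr
  have hint : ∫ s in (0 : ℝ)..2 * π, G (t, s)
      = ∑ j ∈ Finset.range (m + 1), ∫ s in p j..p (j + 1), G (t, s) := by
    rw [intervalIntegral.sum_integral_adjacent_intervals fun j _ => hcont.intervalIntegrable _ _]
    congr 1
    · simp [hp]
    · simp only [hp]
      rw [mul_div_assoc, ← hN, div_self hNpos.ne', mul_one]
  have hpiece : ∀ j ∈ Finset.range (m + 1),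
      |2 * π / N * G (t, p j) - ∫ s in p j..p (j + 1), G (t, s)| ≤ ε * (2 * π / N) := by
    intro j hj
    rw [Finset.mem_range] at hj
    have e : 2 * π / N * G (t, p j) - ∫ s in p j..p (j + 1), G (t, s)
        = ∫ s in p j..p (j + 1), (G (t, p j) - G (t, s)) := by
      rw [intervalIntegral.integral_sub intervalIntegrable_const (hcont.intervalIntegrable _ _),
        intervalIntegral.integral_const, hstep, smul_eq_mul]
    have hle : p j ≤ p (j + 1) := by
      have := hstep j
      have : 0 < 2 * π / N := by positivity
      linarith
    rw [e]
    have h := intervalIntegral.norm_integral_le_of_norm_le_const (a := p j) (b := p (j + 1))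
      (f := fun s => G (t, p j) - G (t, s)) (C := ε) fun s hs => ?_
    · rwa [hstep, abs_of_pos (by positivity), Real.norm_eq_abs] at h
    · rw [Set.uIoc_of_le hle] at hs
      have h1 := hpmem j hj.le
      have h2 := hpmem (j + 1) hj
      refine (huc (t, p j) ⟨ht, h1⟩ (t, s) ⟨ht, ⟨h1.1.trans hs.1.le, hs.2.trans h2.2⟩⟩ ?_).le
      rw [Prod.dist_eq, dist_self, Real.dist_eq]
      refine max_lt hδ (lt_of_le_of_lt ?_ hm)
      rw [abs_sub_comm, abs_of_pos (by linarith [hs.1]), ← hstep j]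
      linarith [hs.2]
  have hsum : |∑ j ∈ Finset.range (m + 1), 2 * π / N * G (t, p j) - ∫ s in (0 : ℝ)..2 * π, G (t, s)|
      ≤ ε * (2 * π) := by
    rw [hint, ← Finset.sum_sub_distrib]
    refine (Finset.abs_sum_le_sum_abs _ _).trans ((Finset.sum_le_sum hpiece).trans (le_of_eq ?_))
    rw [Finset.sum_const, Finset.card_range, nsmul_eq_mul, ← hN]
    field_simp
  rw [sum_zmod_angle m fun s => G (t, s), mean]
  have e : 1 / N * ∑ j ∈ Finset.range (m + 1), G (t, p j)
        - (2 * π)⁻¹ * ∫ s in (0 : ℝ)..2 * π, G (t, s)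
      = (2 * π)⁻¹ * (∑ j ∈ Finset.range (m + 1), 2 * π / N * G (t, p j)
        - ∫ s in (0 : ℝ)..2 * π, G (t, s)) := by
    rw [← Finset.mul_sum]
    field_simp
  rw [e, abs_mul, abs_of_pos (by positivity)]
  refine (mul_le_mul_of_nonneg_left hsum (by positivity)).trans (le_of_eq ?_)
  field_simp

lemma tendsto_riemann_sum {g : ℝ → ℝ} (hg : Continuous g) :
    Tendsto (fun m : ℕ => (1 / (m + 1 : ℕ) : ℝ) * ∑ i : ZMod (m + 1), g (angle i)) atTop
      (𝓝 (mean g)) := by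
  rw [Metric.tendsto_nhds]
  intro ε hε
  have h := eventually_abs_riemann_sum_sub_mean_le (G := fun p => g p.2) (by fun_prop)
    (half_pos hε)
  filter_upwards [h] with m hm
  rw [Real.dist_eq]
  exact (hm 0 ⟨le_rfl, two_pi_pos.le⟩).trans_lt (half_lt_self hε)

end Grid

end Babenko

namespace Babenko

open Real Filter Topology

/-- The number of grid points in a closed set is asymptotically at most its measure. -/
lemma eventually_card_le {g : ℝ → ℝ} (hg : Continuous g) {ν : ℝ}
    (hν : volume.real {t : ℝ | t ∈ Set.Icc 0 (2 * π) ∧ 1 ≤ g t} < ν * (2 * π)) :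
    ∀ᶠ m : ℕ in atTop, ((Finset.univ.filter fun i : ZMod (m + 1) => 1 ≤ g (angle i)).card : ℝ)
      ≤ ν * (m + 1 : ℕ) := by
  set S : Set ℝ := {t | 1 ≤ g t} with hS
  have hSm : MeasurableSet S := measurableSet_le measurable_const hg.measurable
  set h : ℕ → ℝ → ℝ := fun k t => max 0 (1 - k * max 0 (1 - g t)) with hh
  have hcont : ∀ k, Continuous (h k) := fun k => by simp only [hh]; fun_prop
  have h0 : ∀ k t, 0 ≤ h k t := fun k t => le_max_left _ _
  have h1 : ∀ k t, h k t ≤ 1 := fun k t => by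
    have : 0 ≤ (k : ℝ) * max 0 (1 - g t) := by positivity
    exact max_le zero_le_one (by linarith)
  have hone : ∀ k t, 1 ≤ g t → h k t = 1 := fun k t ht => by
    simp [hh, max_eq_left (sub_nonpos.2 ht)]
  have hlim : Tendsto (fun k => ∫ t in (0 : ℝ)..2 * π, h k t) atTop
      (𝓝 (∫ t in (0 : ℝ)..2 * π, S.indicator (fun _ => (1 : ℝ)) t)) := by
    refine intervalIntegral.tendsto_integral_filter_of_dominated_convergence (fun _ => 1)
      (Eventually.of_forall fun k => (hcont k).aestronglyMeasurable)
      (Eventually.of_forall fun k => Eventually.of_forall fun t _ => ?_)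
      intervalIntegrable_const (Eventually.of_forall fun t _ => ?_)
    · rw [Real.norm_eq_abs, abs_of_nonneg (h0 k t)]
      exact h1 k t
    · by_cases ht : t ∈ S
      · rw [Set.indicator_of_mem ht]
        exact tendsto_const_nhds.congr fun k => (hone k t ht).symm
      · rw [Set.indicator_of_notMem ht]
        have hpos : 0 < 1 - g t := sub_pos.2 (not_le.1 ht)
        obtain ⟨K, hK⟩ := exists_nat_gt (1 / (1 - g t))
        refine tendsto_const_nhds.congr' (eventually_atTop.2 ⟨K, fun k hk => ?_⟩)
        have hk' : (K : ℝ) ≤ k := by exact_mod_cast hk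
        rw [div_lt_iff₀ hpos] at hK
        simp only [hh]
        rw [max_eq_right hpos.le, max_eq_left]
        nlinarith
  have hvol : ∫ t in (0 : ℝ)..2 * π, S.indicator (fun _ => (1 : ℝ)) t
      = volume.real {t : ℝ | t ∈ Set.Icc 0 (2 * π) ∧ 1 ≤ g t} := by
    rw [intervalIntegral.integral_of_le two_pi_pos.le, ← integral_Icc_eq_integral_Ioc,
      setIntegral_indicator hSm, setIntegral_const, smul_eq_mul, mul_one]
    rfl
  rw [hvol] at hlim
  obtain ⟨k, hk⟩ := (hlim.eventually_lt_const hν).exists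
  have hmean : mean (h k) < ν := by
    unfold mean
    rw [inv_mul_lt_iff₀ two_pi_pos, mul_comm _ ν]
    exact hk
  filter_upwards [(tendsto_riemann_sum (hcont k)).eventually_lt_const hmean] with m hm
  have hN : (0 : ℝ) < (m + 1 : ℕ) := by positivity
  have hle : ((Finset.univ.filter fun i : ZMod (m + 1) => 1 ≤ g (angle i)).card : ℝ)
      ≤ ∑ i : ZMod (m + 1), h k (angle i) := by
    rw [Finset.card_filter]
    push_cast
    refine Finset.sum_le_sum fun i _ => ?_
    split_ifs with hi
    · exact (hone k _ hi).ge
    · exact h0 k _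
  refine hle.trans ?_
  rw [one_div, inv_mul_lt_iff₀ hN] at hm
  linarith

/-- The torsion comparison for the Poisson averaging operator. -/
theorem mean_sq_le_of_poisson {v y : ℝ → ℝ} (hv : Continuous v) (hy : Continuous y)
    (hv0 : ∀ t, 0 ≤ v t) (hy0 : ∀ t, 0 ≤ y t) {r : ℝ} (hr : 0 < r) (hr1 : r < 1)
    {B B₁ B₀ x₀ : ℝ} (hB : 0 < B) (h₁ : ∀ t, v t - poisson r v t ≤ B₁)
    (h₀ : ∀ t, y t - poisson r y t ≤ B₀) (h : ∀ t, x₀ ≤ cos t → B ≤ y t - poisson r y t)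
    (hcard : ∀ᶠ m : ℕ in atTop, (Finset.univ.filter fun i : ZMod (m + 1) => 0 < v (angle i)).card
      ≤ (Finset.univ.filter fun i : ZMod (m + 1) => x₀ ≤ cos (angle i)).card) :
    (B * mean v) ^ 2 ≤ (B₁ * mean v) * (B₀ * mean y) := by
  have hker := continuous_cosKernel_cos hr hr1
  have hmean : ∀ u : ℝ → ℝ, Continuous u → ∀ t,
      mean (fun s => cosKernel r (cos (t - s)) * (u t - u s)) = u t - poisson r u t := by
    intro u hu t
    have e : ∀ s, cosKernel r (cos (t - s)) * (u t - u s)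
        = u t * (cosKernel r (cos (t - s)) * 1) + (-1) * (cosKernel r (cos (t - s)) * u s) :=
      fun s => by ring
    have c1 := continuous_poisson_integrand hr hr1 (continuous_const (y := (1 : ℝ))) t
    have c2 := continuous_poisson_integrand hr hr1 hu t
    have c1' : Continuous fun s => u t * (cosKernel r (cos (t - s)) * 1) := continuous_const.mul c1
    have c2' : Continuous fun s => (-1) * (cosKernel r (cos (t - s)) * u s) :=
      continuous_const.mul c2
    simp only [e]
    rw [mean_add c1' c2', mean_const_mul,
      mean_const_mul]
    have := poisson_const hr hr1 1 t
    unfold poisson at this ⊢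
    rw [this]
    ring
  have hG : ∀ u : ℝ → ℝ, Continuous u →
      Continuous fun p : ℝ × ℝ => cosKernel r (cos (p.1 - p.2)) * (u p.1 - u p.2) := fun u hu =>
    hker.mul (by fun_prop)
  have main : ∀ ε, 0 < ε → ε < B →
      ((B - ε) * mean v) ^ 2 ≤ ((B₁ + ε) * mean v) * ((B₀ + ε) * mean y) := by
    intro ε hε hεB
    have tv := tendsto_riemann_sum hv
    have ty := tendsto_riemann_sum hy
    refine le_of_tendsto_of_tendsto ((tv.const_mul (B - ε)).pow 2)
      ((tv.const_mul (B₁ + ε)).mul (ty.const_mul (B₀ + ε))) ?_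
    filter_upwards [hcard, eventually_abs_riemann_sum_sub_mean_le (hG v hv) hε,
      eventually_abs_riemann_sum_sub_mean_le (hG y hy) hε] with m hm hvm hym
    have hN : (0 : ℝ) < (m + 1 : ℕ) := by positivity
    set N : ℝ := ((m + 1 : ℕ) : ℝ)
    obtain ⟨σ, hσ, hσs⟩ := exists_perm_supported (K := cosKernel r)
      (fun x _ z hz hxz => cosKernel_mono hr hr1 hxz hz.2) hm
    have hpull : ∀ (u : ℝ → ℝ) (i : ZMod (m + 1)),
        ∑ j : ZMod (m + 1), 1 / N * cosKernel r (cos (angle i - angle j)) * (u (angle i) - u (angle j))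
        = 1 / N * ∑ j : ZMod (m + 1), cosKernel r (cos (angle i - angle j)) * (u (angle i) - u (angle j)) := by
      intro u i
      rw [Finset.mul_sum]
      exact Finset.sum_congr rfl fun j _ => by ring
    have hcomp := dirichlet_comparison
      (k := fun i j : ZMod (m + 1) => 1 / N * cosKernel r (cos (angle i - angle j)))
      (κ := ∑ j : ZMod (m + 1), 1 / N * cosKernel r (cos (angle j)))
      (v := fun i => v (angle i)) (y := fun i => y (angle i))
      (B := B - ε) (B₁ := B₁ + ε) (B₀ := B₀ + ε)
      (fun i j => by rw [← cos_neg, neg_sub])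
      (fun i j => mul_nonneg (by positivity) (cosKernel_nonneg hr hr1 (cos_le_one _)))
      (fun i => by
        simp only [← cos_angle_sub]
        exact Equiv.sum_comp (Equiv.subLeft i) fun j => 1 / N * cosKernel r (cos (angle j)))
      σ (fun i => hv0 _) (fun i => hy0 _) (by linarith)
      (by
        simp only [mul_assoc, ← Finset.mul_sum]
        exact mul_le_mul_of_nonneg_left hσ (by positivity))
      (fun i => by
        have h2 := (abs_le.1 (hvm _ (angle_mem i))).2
        rw [hmean v hv] at h2
        rw [hpull]
        linarith [h₁ (angle i)])
      (fun i => by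
        have h2 := (abs_le.1 (hym _ (angle_mem i))).2
        rw [hmean y hy] at h2
        rw [hpull]
        linarith [h₀ (angle i)])
      (fun i hi => by
        have h2 := (abs_le.1 (hym _ (angle_mem i))).1
        rw [hmean y hy] at h2
        rw [hpull]
        linarith [h (angle i) (hσs i hi)])
    have hfin := mul_le_mul_of_nonneg_left hcomp (by positivity : 0 ≤ (1 / N) ^ 2)
    calc ((B - ε) * (1 / N * ∑ i : ZMod (m + 1), v (angle i))) ^ 2
        = (1 / N) ^ 2 * ((B - ε) * ∑ i : ZMod (m + 1), v (angle i)) ^ 2 := by ring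
      _ ≤ _ := hfin
      _ = _ := by ring
  have hc : ∀ a : ℝ, Tendsto (fun ε : ℝ => a + ε) (𝓝[>] 0) (𝓝 a) := fun a => by
    have : Continuous fun ε : ℝ => a + ε := by fun_prop
    simpa using (this.tendsto 0).mono_left nhdsWithin_le_nhds
  have hc' : Tendsto (fun ε : ℝ => B - ε) (𝓝[>] 0) (𝓝 B) := by
    have : Continuous fun ε : ℝ => B - ε := by fun_prop
    simpa using (this.tendsto 0).mono_left nhdsWithin_le_nhds
  refine le_of_tendsto_of_tendsto ((hc'.mul_const (mean v)).pow 2)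
    (((hc B₁).mul_const _).mul ((hc B₀).mul_const _)) ?_
  filter_upwards [Ioo_mem_nhdsGT hB] with ε hε
  exact main ε hε.1 hε.2

lemma cos_le_cos_iff_mem {β : ℝ} (hβ0 : 0 ≤ β) (hβ : β ≤ π) {t : ℝ}
    (ht : t ∈ Set.Icc 0 (2 * π)) : cos t ≤ cos β ↔ t ∈ Set.Icc β (2 * π - β) := by
  rcases le_total t π with h | h
  · rw [(strictAntiOn_cos.le_iff_ge ⟨ht.1, h⟩ ⟨hβ0, hβ⟩), Set.mem_Icc]
    exact ⟨fun h => ⟨h, by linarith⟩, fun h => h.1⟩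
  · rw [← cos_two_pi_sub, (strictAntiOn_cos.le_iff_ge ⟨by linarith [ht.2], by linarith⟩ ⟨hβ0, hβ⟩),
      Set.mem_Icc]
    exact ⟨fun h => ⟨by linarith, by linarith⟩, fun h => by linarith [h.2]⟩

lemma volume_cos_le {β : ℝ} (hβ0 : 0 ≤ β) (hβ : β ≤ π) :
    volume.real {t : ℝ | t ∈ Set.Icc 0 (2 * π) ∧ cos t ≤ cos β} = 2 * π - 2 * β := by
  have : {t : ℝ | t ∈ Set.Icc 0 (2 * π) ∧ cos t ≤ cos β} = Set.Icc β (2 * π - β) := by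
    ext t
    simp only [Set.mem_ofPred_eq]
    constructor
    · rintro ⟨h1, h2⟩
      exact (cos_le_cos_iff_mem hβ0 hβ h1).1 h2
    · intro h
      have h1 : t ∈ Set.Icc 0 (2 * π) := ⟨hβ0.trans h.1, by linarith [h.2]⟩
      exact ⟨h1, (cos_le_cos_iff_mem hβ0 hβ h1).2 h⟩
  rw [this, Real.volume_real_Icc_of_le (by linarith)]
  ring

/-- For an arc longer than the measure of `{|f| ≥ 1}` the grid points of `{|f| > 1}` are
eventually fewer than those of the arc. -/
lemma eventually_card_le_card {f : ℝ → ℝ} (hf : Continuous f) {β : ℝ} (hβ0 : 0 ≤ β) (hβ : β ≤ π)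
    (hμ : mu f < 2 * β) :
    ∀ᶠ m : ℕ in atTop,
      (Finset.univ.filter fun i : ZMod (m + 1) => 0 < green (f (angle i))).card
      ≤ (Finset.univ.filter fun i : ZMod (m + 1) => cos β ≤ cos (angle i)).card := by
  have hpi := two_pi_pos
  set η := (2 * β - mu f) / 2 / (2 * π) with hη
  have hη0 : 0 < η := by
    rw [hη]
    have : 0 < 2 * β - mu f := by linarith
    positivity
  have hη2 : η * (2 * π) = (2 * β - mu f) / 2 := by rw [hη]; field_simp
  have e1 := eventually_card_le (g := fun t => |f t|) (by fun_prop) (ν := mu f / (2 * π) + η) (by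
    change mu f < _
    rw [add_mul, div_mul_cancel₀ _ hpi.ne', hη2]
    linarith)
  have e2 := eventually_card_le (g := fun t => 1 + (cos β - cos t)) (by fun_prop)
    (ν := (2 * π - 2 * β) / (2 * π) + η) (by
    have : {t : ℝ | t ∈ Set.Icc 0 (2 * π) ∧ 1 ≤ 1 + (cos β - cos t)}
        = {t : ℝ | t ∈ Set.Icc 0 (2 * π) ∧ cos t ≤ cos β} := by
      ext t
      simp
    rw [this, volume_cos_le hβ0 hβ, add_mul, div_mul_cancel₀ _ hpi.ne', hη2]
    linarith)
  filter_upwards [e1, e2] with m h1 h2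
  have hsub : (Finset.univ.filter fun i : ZMod (m + 1) => 0 < green (f (angle i))).card
      ≤ (Finset.univ.filter fun i : ZMod (m + 1) => 1 ≤ |f (angle i)|).card := by
    refine Finset.card_le_card fun i hi => ?_
    rw [Finset.mem_filter_univ] at hi ⊢
    by_contra! hlt
    exact hi.ne' (green_eq_zero hlt.le)
  have hsub2 : (Finset.univ.filter fun i : ZMod (m + 1) => ¬ cos β ≤ cos (angle i)).card
      ≤ (Finset.univ.filter fun i : ZMod (m + 1) => 1 ≤ 1 + (cos β - cos (angle i))).card := by
    refine Finset.card_le_card fun i hi => ?_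
    rw [Finset.mem_filter_univ] at hi ⊢
    linarith
  have htot := Finset.card_filter_add_card_filter_not
    (s := (Finset.univ : Finset (ZMod (m + 1)))) fun i => cos β ≤ cos (angle i)
  rw [Finset.card_univ, ZMod.card] at htot
  have hsum : (mu f / (2 * π) + η) + ((2 * π - 2 * β) / (2 * π) + η) = 1 := by
    rw [hη]
    field_simp
    ring
  have hfin : (((Finset.univ.filter fun i : ZMod (m + 1) => 0 < green (f (angle i))).card : ℕ) : ℝ)
      ≤ (Finset.univ.filter fun i : ZMod (m + 1) => cos β ≤ cos (angle i)).card := by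
    have a1 : (((Finset.univ.filter fun i : ZMod (m + 1) => 0 < green (f (angle i))).card : ℕ) : ℝ)
        ≤ (mu f / (2 * π) + η) * (m + 1 : ℕ) := le_trans (by exact_mod_cast hsub) h1
    have a2 : (((Finset.univ.filter fun i : ZMod (m + 1) => ¬ cos β ≤ cos (angle i)).card : ℕ) : ℝ)
        ≤ ((2 * π - 2 * β) / (2 * π) + η) * (m + 1 : ℕ) := le_trans (by exact_mod_cast hsub2) h2
    have a3 : (((Finset.univ.filter fun i : ZMod (m + 1) => cos β ≤ cos (angle i)).card : ℕ) : ℝ)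
        + (Finset.univ.filter fun i : ZMod (m + 1) => ¬ cos β ≤ cos (angle i)).card
        = (m + 1 : ℕ) := by exact_mod_cast htot
    have a4 : (mu f / (2 * π) + η) * (m + 1 : ℕ) + ((2 * π - 2 * β) / (2 * π) + η) * (m + 1 : ℕ)
        = (m + 1 : ℕ) := by rw [← add_mul, hsum, one_mul]
    linarith
  exact_mod_cast hfin

lemma mu_nonneg (f : ℝ → ℝ) : 0 ≤ mu f := measureReal_nonneg

lemma mean_green_le_of_lt {f : ℝ → ℝ} {n A : ℝ} (hf : Continuous f) (hn : 0 ≤ n)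
    (hpot : IsLogPot n A fun t => green (f t)) {α : ℝ} (hμ : mu f < α) (hα : α < 2 * π) :
    mean (fun t => green (f t)) ≤ n * log (1 / cos (α / 4) ^ 2) := by
  set v : ℝ → ℝ := fun t => green (f t) with hv
  have hμ0 := mu_nonneg f
  set c := cos (α / 4) with hc
  have hc0 : 0 < c := cos_pos_of_mem_Ioo ⟨by linarith [pi_pos], by linarith⟩
  have hc1 : c ≤ 1 := cos_le_one _
  set y : ℝ → ℝ := fun t => green (arcPoly c t) with hy
  have hypot := isLogPot_green_arcPoly hc0
  set β := (mu f + α) / 4 with hβ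
  have hcos2 : cos (α / 2) = 2 * c ^ 2 - 1 := by
    rw [hc, ← cos_two_mul]
    ring_nf
  have hlt : cos (α / 2) < cos β :=
    cos_lt_cos_of_nonneg_of_le_pi (by linarith) (by linarith) (by linarith)
  set d := (cos β + 1 - 2 * c ^ 2) / 2 with hd
  have hd0 : 0 < d := by linarith
  have hcard := eventually_card_le_card hf (β := β) (by linarith) (by linarith) (by linarith)
  have hym : mean y ≤ log (1 / c ^ 2) := mean_green_arcPoly_le hc0 hc1
  have hlog0 : 0 ≤ log (1 / c ^ 2) := by
    refine log_nonneg ?_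
    rw [le_div_iff₀ (by positivity), one_mul]
    exact pow_le_one₀ hc0.le hc1
  have hineq : ∀ r, 0 < r → r < 1 → 0 < 1 - (1 - r) / (r * d ^ 2) →
      ((1 - (1 - r) / (r * d ^ 2)) * mean v) ^ 2 ≤ n * mean v * mean y := by
    intro r hr hr1 hρ
    set L := log (1 / r) with hL
    have hLr : L = -log r := by rw [hL, one_div, log_inv]
    have hL1 : 1 - r ≤ L := by
      have := log_le_sub_one_of_pos hr
      linarith
    have hLpos : 0 < L := by linarith
    set ρ := 1 - (1 - r) / (r * d ^ 2) with hρd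
    have hB : ∀ t, cos β ≤ cos t → ρ * L ≤ y t - poisson r y t := by
      intro t ht
      have h := poisson_green_arcPoly_sub_le hc0 hc1 hr hr1 (t := t) hd0 (by linarith)
      have h2 : (1 - r) ^ 2 / (r * d ^ 2) ≤ (1 - r) / (r * d ^ 2) * L := by
        rw [div_mul_eq_mul_div, sq]
        have : 0 ≤ 1 - r := by linarith
        gcongr
      rw [hρd, sub_mul, one_mul]
      linarith
    have h := mean_sq_le_of_poisson hpot.continuous hypot.continuous
      (fun t => green_nonneg _) (fun t => green_nonneg _) hr hr1 (mul_pos hρ hLpos)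
      (hpot.sub_poisson_le r hr hr1) (hypot.sub_poisson_le r hr hr1) hB hcard
    have hL2 : 0 < L ^ 2 := by positivity
    refine le_of_mul_le_mul_left ?_ hL2
    calc L ^ 2 * (ρ * mean v) ^ 2 = (ρ * L * mean v) ^ 2 := by ring
      _ ≤ _ := h
      _ = _ := by ring
  have hρlim : Tendsto (fun r : ℝ => 1 - (1 - r) / (r * d ^ 2)) (𝓝[<] 1) (𝓝 1) := by
    have : ContinuousAt (fun r : ℝ => 1 - (1 - r) / (r * d ^ 2)) 1 := by
      refine ContinuousAt.sub continuousAt_const (ContinuousAt.div (by fun_prop) (by fun_prop) ?_)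
      rw [one_mul]
      positivity
    simpa using this.tendsto.mono_left nhdsWithin_le_nhds
  have hsq : (1 * mean v) ^ 2 ≤ n * mean v * mean y := by
    refine le_of_tendsto ((hρlim.mul_const (mean v)).pow 2) ?_
    filter_upwards [hρlim.eventually_const_lt zero_lt_one, Ioo_mem_nhdsLT zero_lt_one]
      with r h1 h2
    exact hineq r h2.1 h2.2 h1
  rcases le_or_gt (mean v) 0 with h | h
  · exact h.trans (mul_nonneg hn hlog0)
  · have : mean v ≤ n * mean y := by
      refine le_of_mul_le_mul_left ?_ h
      nlinarith
    exact this.trans (mul_le_mul_of_nonneg_left hym hn)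

/-- The sharp bound of the leading coefficient by the measure of the set `{|f| ≥ 1}`. -/
theorem leading_mul_cos_pow_le {n : ℕ} (hn : 1 ≤ n) {a b : ℕ → ℝ}
    (hA : 0 < √(a n ^ 2 + b n ^ 2)) (hμ : mu (trigPoly n a b) < 2 * π) :
    √(a n ^ 2 + b n ^ 2) * cos (mu (trigPoly n a b) / 4) ^ (2 * n) ≤ 1 := by
  set A := √(a n ^ 2 + b n ^ 2)
  set μ := mu (trigPoly n a b)
  have hcont : Tendsto (fun α : ℝ => A * cos (α / 4) ^ (2 * n)) (𝓝[>] μ)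
      (𝓝 (A * cos (μ / 4) ^ (2 * n))) := by
    have : Continuous fun α : ℝ => A * cos (α / 4) ^ (2 * n) := by fun_prop
    exact (this.tendsto μ).mono_left nhdsWithin_le_nhds
  refine le_of_tendsto hcont ?_
  filter_upwards [Ioo_mem_nhdsGT hμ] with α hα
  have hpot := isLogPot_green_trigPoly hn hA
  have h := hpot.le_mean.trans
    (mean_green_le_of_lt (continuous_trigPoly n a b) (Nat.cast_nonneg n) hpot hα.1 hα.2)
  have hμ0 : 0 ≤ μ := mu_nonneg _
  have hc0 : 0 < cos (α / 4) :=
    cos_pos_of_mem_Ioo ⟨by linarith [pi_pos, hα.1], by linarith [hα.2]⟩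
  rw [← log_pow, log_le_log_iff hA (by positivity), one_div, inv_pow, ← pow_mul] at h
  calc A * cos (α / 4) ^ (2 * n) ≤ (cos (α / 4) ^ (2 * n))⁻¹ * cos (α / 4) ^ (2 * n) := by gcongr
    _ = 1 := inv_mul_cancel₀ (by positivity)

end Babenko

namespace Babenko

open Real Filter Topology

section Measure

lemma mu_eq_integral {g : ℝ → Prop} (hg : MeasurableSet {t | g t}) :
    volume.real {t : ℝ | t ∈ Set.Icc 0 (2 * π) ∧ g t}
      = ∫ t in (0 : ℝ)..2 * π, {t | g t}.indicator (fun _ => (1 : ℝ)) t := by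
  rw [intervalIntegral.integral_of_le two_pi_pos.le, ← integral_Icc_eq_integral_Ioc,
    setIntegral_indicator hg, setIntegral_const, smul_eq_mul, mul_one]
  rfl

/-- The measure of a sublevel set of the cosine is invariant under dilations and shifts. -/
lemma volume_cos_comp_le {N : ℕ} (hN : 1 ≤ N) (ψ : ℝ) {β : ℝ} (hβ0 : 0 ≤ β) (hβ : β ≤ π) :
    volume.real {t : ℝ | t ∈ Set.Icc 0 (2 * π) ∧ cos (N * t - ψ) ≤ cos β} = 2 * π - 2 * β := by
  have hN' : (0 : ℝ) < N := by exact_mod_cast hN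
  set χ : ℝ → ℝ := {t | cos t ≤ cos β}.indicator fun _ => (1 : ℝ) with hχ
  have hm : MeasurableSet {t | cos t ≤ cos β} := measurableSet_le measurable_cos measurable_const
  have hper : Function.Periodic χ (2 * π) := fun t => by
    simp only [hχ, Set.indicator, Set.mem_ofPred_eq, cos_add_two_pi]
  have hcomp : ∀ t : ℝ, {t : ℝ | cos (N * t - ψ) ≤ cos β}.indicator (fun _ => (1 : ℝ)) t
      = χ (N * t - ψ) := fun t => rfl
  rw [mu_eq_integral (measurableSet_le (by fun_prop) measurable_const)]
  simp only [hcomp]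
  rw [intervalIntegral.integral_comp_mul_sub χ hN'.ne', mul_zero, zero_sub]
  have e : (N : ℝ) * (2 * π) - ψ = -ψ + (N : ℤ) • (2 * π) := by
    simp
    ring
  rw [e, hper.intervalIntegral_add_zsmul_eq _ _ (fun a b => ?_),
    hper.intervalIntegral_add_eq _ 0, zero_add, hχ, ← mu_eq_integral hm, volume_cos_le hβ0 hβ]
  · simp
    field_simp
  · exact (intervalIntegrable_const (c := (1 : ℝ))).mono_fun
      ((measurable_const.indicator hm).aestronglyMeasurable)
      (Eventually.of_forall fun t => norm_indicator_le_norm_self _ _)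

lemma harmonic_eq (n : ℕ) (a b : ℕ → ℝ) : ∃ φ : ℝ, ∀ t,
    harmonic n a b t = √(a n ^ 2 + b n ^ 2) * cos (n * t - φ) := by
  set z : ℂ := a n + b n * Complex.I with hz
  have hre : z.re = a n := by simp [hz]
  have him : z.im = b n := by simp [hz]
  have hnorm : ‖z‖ = √(a n ^ 2 + b n ^ 2) := by
    rw [Complex.norm_def, Complex.normSq_apply, hre, him]
    ring_nf
  refine ⟨z.arg, fun t => ?_⟩
  have h1 := Complex.norm_mul_cos_arg z
  have h2 := Complex.norm_mul_sin_arg z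
  rw [← hnorm, cos_sub, mul_add, harmonic, ← hre, ← him, ← h1, ← h2]
  ring

lemma mu_harmonic_of_lt_one {n : ℕ} {a b : ℕ → ℝ} (hA : √(a n ^ 2 + b n ^ 2) < 1) :
    mu (harmonic n a b) = 0 := by
  obtain ⟨φ, hφ⟩ := harmonic_eq n a b
  have : {t : ℝ | t ∈ Set.Icc 0 (2 * π) ∧ 1 ≤ |harmonic n a b t|} = ∅ := by
    ext t
    simp only [Set.mem_ofPred_eq, Set.mem_empty_iff_false, iff_false, not_and, not_le]
    intro _
    rw [hφ, abs_mul, abs_of_nonneg (sqrt_nonneg _)]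
    exact (mul_le_of_le_one_right (sqrt_nonneg _) (abs_cos_le_one _)).trans_lt hA
  rw [mu, this, measureReal_empty]

lemma mu_harmonic {n : ℕ} (hn : 1 ≤ n) {a b : ℕ → ℝ} (hA : 1 ≤ √(a n ^ 2 + b n ^ 2)) :
    mu (harmonic n a b) = 4 * arccos (1 / √(a n ^ 2 + b n ^ 2)) := by
  obtain ⟨φ, hφ⟩ := harmonic_eq n a b
  set A := √(a n ^ 2 + b n ^ 2)
  have hA0 : 0 < A := by linarith
  set γ := arccos (1 / A) with hγ
  have hγ0 : 0 ≤ γ := arccos_nonneg _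
  have hγ1 : γ ≤ π / 2 := arccos_le_pi_div_two.2 (by positivity)
  have hcosγ : cos γ = 1 / A := cos_arccos (by
    have : 0 < 1 / A := by positivity
    linarith) (by rw [div_le_iff₀ hA0]; linarith)
  have hset : {t : ℝ | t ∈ Set.Icc 0 (2 * π) ∧ 1 ≤ |harmonic n a b t|}
      = {t : ℝ | t ∈ Set.Icc 0 (2 * π) ∧
        cos ((2 * n : ℕ) * t - (2 * φ + π)) ≤ cos (π - 2 * γ)} := by
    ext t
    simp only [Set.mem_ofPred_eq]
    refine and_congr_right fun _ => ?_
    have e : ((2 * n : ℕ) : ℝ) * t - (2 * φ + π) = 2 * (n * t - φ) - π := by push_cast; ring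
    rw [hφ, e, cos_sub_pi, cos_pi_sub, cos_two_mul, cos_two_mul, hcosγ, ← one_le_sq_iff_one_le_abs,
      mul_pow, div_pow, one_pow]
    have hA2 : 0 < A ^ 2 := by positivity
    rw [neg_le_neg_iff, sub_le_sub_iff_right, mul_le_mul_iff_right₀ two_pos, div_le_iff₀ hA2,
      mul_comm]
  rw [mu, hset, volume_cos_comp_le (by omega) _ (by linarith) (by linarith)]
  ring

end Measure

section CosPow

lemma mul_sin_mul_cos_le {k : ℝ} (hk : 1 ≤ k) {x : ℝ} (hx0 : 0 ≤ x) (hx : k * x ≤ π / 2) :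
    k * sin x * cos (k * x) ≤ sin (k * x) * cos x := by
  set g : ℝ → ℝ := fun x => sin (k * x) * cos x - k * sin x * cos (k * x) with hg
  have hd : ∀ x, HasDerivAt g ((k ^ 2 - 1) * (sin x * sin (k * x))) x := by
    intro x
    have hkx : HasDerivAt (fun x : ℝ => k * x) k x := by
      simpa using (hasDerivAt_id x).const_mul k
    have h := ((hkx.sin).mul (hasDerivAt_cos x)).sub
      (((hasDerivAt_sin x).const_mul k).mul hkx.cos)
    exact h.congr_deriv (by ring)
  have hmono : MonotoneOn g (Set.Icc 0 (π / 2 / k)) := by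
    refine monotoneOn_of_deriv_nonneg (convex_Icc _ _)
      (fun x _ => (hd x).continuousAt.continuousWithinAt)
      (fun x _ => (hd x).differentiableAt.differentiableWithinAt) fun y hy => ?_
    rw [interior_Icc] at hy
    rw [(hd y).deriv]
    have hk0 : 0 < k := by linarith
    have h1 := hy.2
    rw [lt_div_iff₀ hk0] at h1
    have h2 : y ≤ π := by nlinarith [hy.1, pi_pos]
    refine mul_nonneg (by nlinarith) (mul_nonneg (sin_nonneg_of_nonneg_of_le_pi hy.1.le h2)
      (sin_nonneg_of_nonneg_of_le_pi (by nlinarith [hy.1]) (by linarith [pi_pos])))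
  have hk0 : 0 < k := by linarith
  have h := hmono (a := 0) (b := x) ⟨le_rfl, by positivity⟩
    ⟨hx0, by rw [le_div_iff₀ hk0]; linarith⟩ hx0
  simp only [hg, mul_zero, sin_zero, cos_zero, zero_mul, sub_zero] at h
  linarith

/-- `cos (√m x) ≤ cos x ^ m`. -/
lemma cos_sqrt_mul_le_cos_pow {m : ℕ} (hm : 1 ≤ m) {x : ℝ} (hx0 : 0 ≤ x)
    (hx : √m * x < π / 2) : cos (√m * x) ≤ cos x ^ m := by
  set k := √(m : ℝ) with hkd
  have hk2 : k ^ 2 = m := sq_sqrt (Nat.cast_nonneg m)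
  have hm' : (1 : ℝ) ≤ m := by exact_mod_cast hm
  have hk : 1 ≤ k := one_le_sqrt.2 hm'
  have hk0 : 0 < k := by linarith
  have hmem : ∀ y ∈ Set.Icc 0 x, 0 < cos y ∧ k * y ≤ π / 2 := fun y hy => by
    have h1 : k * y ≤ k * x := by gcongr; exact hy.2
    have h2 : y ≤ k * y := le_mul_of_one_le_left hy.1 hk
    exact ⟨cos_pos_of_mem_Ioo ⟨by linarith [hy.1, pi_pos], by linarith⟩, by linarith⟩
  obtain ⟨p, rfl⟩ : ∃ p, m = p + 1 := ⟨m - 1, by omega⟩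
  set g : ℝ → ℝ := fun y => cos (k * y) / cos y ^ (p + 1) with hg
  have hd : ∀ y, 0 < cos y → HasDerivAt g
      ((k * cos y ^ p * (k * sin y * cos (k * y) - sin (k * y) * cos y))
        / (cos y ^ (p + 1)) ^ 2) y := by
    intro y hy
    have hky : HasDerivAt (fun x : ℝ => k * x) k y := by
      simpa using (hasDerivAt_id y).const_mul k
    have h := hky.cos.div ((hasDerivAt_cos y).pow (p + 1)) (pow_pos hy _).ne'
    have hk3 : ((p + 1 : ℕ) : ℝ) = k * k := by rw [← hk2, sq]
    refine h.congr_deriv ?_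
    simp only [hk3, Nat.add_sub_cancel, Pi.pow_apply]
    ring
  have hanti : AntitoneOn g (Set.Icc 0 x) := by
    refine antitoneOn_of_deriv_nonpos (convex_Icc _ _)
      (fun y hy => (hd y (hmem y hy).1).continuousAt.continuousWithinAt)
      (fun y hy => (hd y (hmem y (interior_subset hy)).1).differentiableAt.differentiableWithinAt)
      fun y hy => ?_
    have hy' := interior_subset hy
    obtain ⟨hc, hky⟩ := hmem y hy'
    rw [(hd y hc).deriv]
    refine div_nonpos_of_nonpos_of_nonneg ?_ (by positivity)
    exact mul_nonpos_of_nonneg_of_nonpos (by positivity)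
      (sub_nonpos.2 (mul_sin_mul_cos_le hk hy'.1 hky))
  have h := hanti (a := 0) (b := x) ⟨le_rfl, hx0⟩ ⟨hx0, le_rfl⟩ hx0
  simp only [hg, mul_zero, cos_zero, one_pow, div_one] at h
  rwa [div_le_one (pow_pos (hmem x ⟨hx0, le_rfl⟩).1 _)] at h

end CosPow

section Sharpness

open Polynomial

/-- A polynomial in the cosine is an even trigonometric polynomial. -/
lemma exists_trigPoly_eq_eval_cos (n : ℕ) : ∀ p : ℝ[X], p.natDegree ≤ n →
    ∃ a : ℕ → ℝ, (∀ t, trigPoly n a 0 t = p.eval (cos t))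
      ∧ (1 ≤ n → a n = p.coeff n / 2 ^ (n - 1)) := by
  induction n with
  | zero =>
    intro p hp
    rw [Nat.le_zero, natDegree_eq_zero] at hp
    obtain ⟨x, rfl⟩ := hp
    exact ⟨fun _ => 2 * x, fun t => by simp [trigPoly], fun h => by omega⟩
  | succ n ih =>
    intro p hp
    set k := p.coeff (n + 1) / 2 ^ n with hk
    have hTdeg : (Chebyshev.T ℝ (n + 1 : ℕ)).natDegree = n + 1 := by
      rw [Chebyshev.natDegree_T, Int.natAbs_natCast]
    have hTc : (Chebyshev.T ℝ (n + 1 : ℕ)).coeff (n + 1) = 2 ^ n := by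
      have h := Chebyshev.leadingCoeff_T ℝ ((n + 1 : ℕ) : ℤ)
      rw [leadingCoeff, hTdeg] at h
      rw [h, Int.natAbs_natCast, Nat.add_sub_cancel]
    obtain ⟨a, ha, -⟩ := ih (p - C k * Chebyshev.T ℝ (n + 1 : ℕ)) (by
      rw [natDegree_le_iff_coeff_eq_zero]
      intro N hN
      rw [coeff_sub, coeff_C_mul]
      rcases (Nat.succ_le_of_lt hN).eq_or_lt with h | h
      · rw [← h, Nat.succ_eq_add_one, hTc, hk]
        field_simp
        ring
      · rw [coeff_eq_zero_of_natDegree_lt (hp.trans_lt h),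
          coeff_eq_zero_of_natDegree_lt (hTdeg.trans_lt h)]
        simp)
    refine ⟨Function.update a (n + 1) k, fun t => ?_, fun _ => ?_⟩
    · have h := ha t
      rw [eval_sub, eval_mul, eval_C, Chebyshev.T_real_cos] at h
      rw [trigPoly, Finset.sum_Icc_succ_top (by omega), Function.update_self,
        Function.update_of_ne (by omega)]
      have e : ∑ j ∈ Finset.Icc 1 n, (Function.update a (n + 1) k j * cos (j * t)
            + (0 : ℕ → ℝ) j * sin (j * t))
          = ∑ j ∈ Finset.Icc 1 n, (a j * cos (j * t) + (0 : ℕ → ℝ) j * sin (j * t)) := by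
        refine Finset.sum_congr rfl fun j hj => ?_
        rw [Function.update_of_ne (by have := (Finset.mem_Icc.1 hj).2; omega)]
      rw [e]
      unfold trigPoly at h
      simp only [Pi.zero_apply, zero_mul, add_zero] at h ⊢
      push_cast at h ⊢
      linarith
    · rw [Function.update_self, hk]
      simp

/-- The extremal polynomials, scaled down so that no isolated points matter. -/
lemma exists_extremal {n : ℕ} (hn : 1 ≤ n) {μ l : ℝ} (hμ0 : 0 < μ) (hμ : μ < 2 * π) (hl0 : 0 < l)
    (hl : l < 1) :
    ∃ a : ℕ → ℝ, a n = l / cos (μ / 4) ^ (2 * n) ∧ mu (trigPoly n a 0) ≤ μ := by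
  set c := cos (μ / 4) with hc
  have hc0 : 0 < c := cos_pos_of_mem_Ioo ⟨by linarith [pi_pos], by linarith⟩
  have hi : (1 / c ^ 2 : ℝ) ≠ 0 := by positivity
  set q : ℝ[X] := C (1 / c ^ 2) * X + C (1 / c ^ 2 - 1) with hq
  have hqd : q.natDegree = 1 := natDegree_linear hi
  have hql : q.leadingCoeff = 1 / c ^ 2 := leadingCoeff_linear hi
  set T := Chebyshev.T ℝ (n : ℤ) with hT
  have hTd : T.natDegree = n := by rw [hT, Chebyshev.natDegree_T]; simp
  have hcd : (T.comp q).natDegree = n := by rw [natDegree_comp, hTd, hqd, mul_one]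
  have hcoeff : (C l * T.comp q).coeff n = l * (2 ^ (n - 1) * (1 / c ^ 2) ^ n) := by
    have h := leadingCoeff_comp (p := T) (q := q) (by rw [hqd]; exact one_ne_zero)
    rw [leadingCoeff, hcd, hql, hTd, hT, Chebyshev.leadingCoeff_T] at h
    rw [coeff_C_mul, h]
    simp
  obtain ⟨a, ha, han⟩ := exists_trigPoly_eq_eval_cos n (C l * T.comp q)
    ((natDegree_C_mul_le _ _).trans hcd.le)
  refine ⟨a, ?_, ?_⟩
  · rw [han hn, hcoeff, pow_mul, one_div, inv_pow]
    field_simp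
  · have hvol := volume_cos_comp_le (le_refl 1) π (β := π - μ / 2) (by linarith) (by linarith)
    have e : 2 * π - 2 * (π - μ / 2) = μ := by ring
    rw [e] at hvol
    rw [← hvol, mu]
    refine measureReal_mono ?_ ?_
    · rintro t ⟨ht, h1⟩
      refine ⟨ht, ?_⟩
      rw [Nat.cast_one, one_mul, cos_sub_pi, cos_pi_sub, neg_le_neg_iff]
      by_contra! hlt
      have hcos2 : cos (μ / 2) = 2 * c ^ 2 - 1 := by
        rw [hc, ← cos_two_mul]
        ring_nf
      have hx : |q.eval (cos t)| ≤ 1 := by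
        have e2 : q.eval (cos t) = (1 + cos t) / c ^ 2 - 1 := by
          simp only [hq, eval_add, eval_mul, eval_C, eval_X]
          ring
        rw [e2, abs_le]
        constructor
        · have : 0 ≤ (1 + cos t) / c ^ 2 := div_nonneg (by linarith [neg_one_le_cos t]) (by positivity)
          linarith
        · rw [sub_le_iff_le_add, div_le_iff₀ (by positivity)]
          linarith
      rw [ha, eval_mul, eval_C, eval_comp, abs_mul, abs_of_pos hl0] at h1
      have := Chebyshev.abs_eval_T_real_le_one n hx
      rw [← hT] at this
      nlinarith
    · exact ((measure_mono fun t ht => ht.1).trans_lt measure_Icc_lt_top).ne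

end Sharpness

theorem sqrt_mem_admissibleConstants {n : ℕ} (hn : 1 ≤ n) :
    √(2 * (n : ℝ)) ∈ admissibleConstants n := by
  intro a b
  have hμ0 := mu_nonneg (trigPoly n a b)
  rcases lt_or_ge √(a n ^ 2 + b n ^ 2) 1 with hA | hA
  · rw [mu_harmonic_of_lt_one hA]
    positivity
  rw [mu_harmonic hn hA]
  have key := fun h => leading_mul_cos_pow_le hn (a := a) (b := b) (by linarith) h
  set A := √(a n ^ 2 + b n ^ 2)
  set μ := mu (trigPoly n a b)
  have hA0 : 0 < A := by linarith
  rcases le_or_gt (2 * π) (√(2 * (n : ℝ)) * μ) with hbig | hsmall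
  · have : arccos (1 / A) ≤ π / 2 := arccos_le_pi_div_two.2 (by positivity)
    linarith
  · have h1 : 1 ≤ √(2 * (n : ℝ)) := by
      refine one_le_sqrt.2 ?_
      have : (1 : ℝ) ≤ n := by exact_mod_cast hn
      linarith
    have hμ : μ < 2 * π := by nlinarith
    have hcast : ((2 * n : ℕ) : ℝ) = 2 * (n : ℝ) := by push_cast; ring
    have hcos := cos_sqrt_mul_le_cos_pow (m := 2 * n) (by omega) (x := μ / 4) (by linarith)
      (by rw [hcast]; linarith)
    rw [hcast] at hcos
    have hle : cos (√(2 * (n : ℝ)) * (μ / 4)) ≤ 1 / A := by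
      refine hcos.trans ?_
      rw [le_div_iff₀ hA0, mul_comm]
      exact key hμ
    have hacc := arccos_le_arccos hle
    rw [arccos_cos (by positivity) (by linarith)] at hacc
    linarith

lemma arccos_cos_pow_le {n : ℕ} (hn : 1 ≤ n) {β : ℝ} (hβ : β ∈ admissibleConstants n) {x : ℝ}
    (hx0 : 0 < x) (hx : x < π / 2) : 0 < β ∧ arccos (cos x ^ (2 * n)) ≤ β * x := by
  have hc0 : 0 < cos x := cos_pos_of_mem_Ioo ⟨by linarith [pi_pos], hx⟩
  have hc1 : cos x < 1 := by
    have := cos_lt_cos_of_nonneg_of_le_pi_div_two le_rfl hx.le hx0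
    rwa [cos_zero] at this
  have hC0 : 0 < cos x ^ (2 * n) := by positivity
  have hC1 : cos x ^ (2 * n) < 1 := pow_lt_one₀ hc0.le hc1 (by omega)
  have hstep : ∀ l, cos x ^ (2 * n) < l → l < 1 →
      0 < β ∧ arccos (cos x ^ (2 * n) / l) ≤ β * x := by
    intro l hl hl1
    have hl0 : 0 < l := hC0.trans hl
    obtain ⟨a, ha, hmu⟩ := exists_extremal hn (μ := 4 * x) (by linarith) (by linarith) hl0 hl1
    rw [mul_div_cancel_left₀ x (by norm_num : (4 : ℝ) ≠ 0)] at ha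
    have hA : √(a n ^ 2 + (0 : ℕ → ℝ) n ^ 2) = l / cos x ^ (2 * n) := by
      rw [Pi.zero_apply, zero_pow two_ne_zero, add_zero, ha, sqrt_sq (by positivity)]
    have hA1 : 1 ≤ √(a n ^ 2 + (0 : ℕ → ℝ) n ^ 2) := by
      rw [hA, le_div_iff₀ hC0]
      linarith
    have h := hβ a 0
    rw [mu_harmonic hn hA1, hA, one_div_div] at h
    have hpos : 0 < arccos (cos x ^ (2 * n) / l) := arccos_pos.2 ((div_lt_one hl0).2 hl)
    have hm0 := mu_nonneg (trigPoly n a 0)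
    have hβ0 : 0 < β := by
      by_contra! hneg
      nlinarith
    refine ⟨hβ0, ?_⟩
    have := mul_le_mul_of_nonneg_left hmu hβ0.le
    linarith
  obtain ⟨l, hl, hl1⟩ := exists_between hC1
  refine ⟨(hstep l hl hl1).1, ?_⟩
  have hlim : Tendsto (fun l : ℝ => arccos (cos x ^ (2 * n) / l)) (𝓝[<] 1)
      (𝓝 (arccos (cos x ^ (2 * n) / 1))) := by
    have : ContinuousAt (fun l : ℝ => arccos (cos x ^ (2 * n) / l)) 1 :=
      continuous_arccos.continuousAt.comp
        (ContinuousAt.div continuousAt_const continuousAt_id one_ne_zero)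
    exact this.tendsto.mono_left nhdsWithin_le_nhds
  rw [div_one] at hlim
  refine le_of_tendsto hlim ?_
  filter_upwards [Ioo_mem_nhdsLT hC1] with l hl
  exact (hstep l hl.1 hl.2).2

theorem sqrt_le_of_mem_admissibleConstants {n : ℕ} (hn : 1 ≤ n) {β : ℝ}
    (hβ : β ∈ admissibleConstants n) : √(2 * (n : ℝ)) ≤ β := by
  have hn' : (0 : ℝ) < n := by exact_mod_cast hn
  have hβ0 : 0 < β := (arccos_cos_pow_le hn hβ one_pos (by linarith [pi_gt_three])).1
  have hineq : ∀ x, 0 < x → x < 1 → β * x < π → 2 * n ≤ β ^ 2 * (1 + n * x ^ 2) := by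
    intro x hx0 hx1 hβx
    have hxpi : x < π / 2 := by linarith [pi_gt_three]
    have h := (arccos_cos_pow_le hn hβ hx0 hxpi).2
    have hc0 : 0 < cos x := cos_pos_of_mem_Ioo ⟨by linarith [pi_pos], hxpi⟩
    have hC1 : cos x ^ (2 * n) ≤ 1 := pow_le_one₀ hc0.le (cos_le_one _)
    have hC0 : 0 < cos x ^ (2 * n) := by positivity
    have h1 : cos (β * x) ≤ cos x ^ (2 * n) := by
      have := cos_le_cos_of_nonneg_of_le_pi (arccos_nonneg _) hβx.le h
      rwa [cos_arccos (by linarith) hC1] at this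
    have h2 := one_sub_sq_div_two_le_cos (x := β * x)
    have h3 : cos x ^ 2 * (1 + x ^ 2) ≤ 1 := by
      have h4 := cos_lt_one_div_sqrt_sq_add_one (x := x) (by linarith) (by linarith) hx0.ne'
      have h5 : 0 < √(x ^ 2 + 1) := by positivity
      rw [lt_div_iff₀ h5] at h4
      have h6 : (cos x * √(x ^ 2 + 1)) ^ 2 ≤ 1 := pow_le_one₀ (by positivity) h4.le
      rw [mul_pow, sq_sqrt (by positivity)] at h6
      linarith
    have h4 : cos x ^ (2 * n) * (1 + n * x ^ 2) ≤ 1 := by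
      have hb := one_add_mul_le_pow (a := x ^ 2) (by nlinarith [sq_nonneg x]) n
      calc cos x ^ (2 * n) * (1 + n * x ^ 2) ≤ cos x ^ (2 * n) * (1 + x ^ 2) ^ n := by gcongr
        _ = (cos x ^ 2 * (1 + x ^ 2)) ^ n := by rw [mul_pow, pow_mul]
        _ ≤ 1 := pow_le_one₀ (by positivity) h3
    have h5 : (1 - (β * x) ^ 2 / 2) * (1 + n * x ^ 2) ≤ 1 :=
      le_trans (mul_le_mul_of_nonneg_right (h2.trans h1) (by positivity)) h4
    have hx2 : 0 < x ^ 2 := by positivity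
    refine le_of_mul_le_mul_left ?_ hx2
    nlinarith
  have hlim : Tendsto (fun x : ℝ => β ^ 2 * (1 + n * x ^ 2)) (𝓝[>] 0) (𝓝 (β ^ 2)) := by
    have : Continuous fun x : ℝ => β ^ 2 * (1 + n * x ^ 2) := by fun_prop
    simpa using (this.tendsto 0).mono_left nhdsWithin_le_nhds
  rw [sqrt_le_left hβ0.le]
  refine ge_of_tendsto hlim ?_
  filter_upwards [Ioo_mem_nhdsGT (zero_lt_one (α := ℝ)), Ioo_mem_nhdsGT (div_pos pi_pos hβ0)]
    with x hx hx'
  refine hineq x hx.1 hx.2 ?_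
  have := hx'.2
  rw [lt_div_iff₀ hβ0] at this
  linarith

end Babenko

theorem theorem9 (n : ℕ) (hn : 1 ≤ n) :
    IsLeast (Babenko.admissibleConstants n) (Real.sqrt (2 * (n : ℝ))) :=
  ⟨Babenko.sqrt_mem_admissibleConstants hn,
    fun _ hβ => Babenko.sqrt_le_of_mem_admissibleConstants hn hβ⟩
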